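/- **Circuits.** Consider two kinds of wires, $\mathsf B$ (Boolean) and $\mathsf R$ (real). Let $\mathsf{MixCirc}$ be the prop (strict symmetric monoidal category whose objects are words in $\mathsf B,\mathsf R$) freely generated by: copying $\mathrm{copy}_a\colon a\to aa$ and discarding $\mathrm{del}_a\colon a\to\varepsilon$ for $a\in\{\mathsf B,\mathsf R\}$; the Boolean gates $\wedge\colon\mathsf{BB}\to\mathsf B$, $\neg\colon\mathsf B\to\mathsf B$, $\mathrm{flip}_p\colon\varepsilon\to\mathsf B$ ($p\in[0,1]$); the Gaussian gates $0,1\colon\varepsilon\to\mathsf R$, $+\colon\mathsf{RR}\to\mathsf R$, $k\cdot\colon\mathsf R\to\mathsf R$ ($k\in\mathbb R$), $\mathrm N\colon\varepsilon\to\mathsf R$; and $\mathrm{ite}\colon\mathsf{BRR}\to\mathsf R$. Circuits are morphisms of $\mathsf{MixCirc}$. A circuit $\mathsf B^p\to\mathsf B^q$ is Boolean if it is built from $\mathrm{copy}_{\mathsf B},\mathrm{del}_{\mathsf B}$ and the Boolean gates only; a circuit $\mathsf R^m\to\mathsf R^n$ is Gaussian if it is built from $\mathrm{copy}_{\mathsf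 R},\mathrm{del}_{\mathsf R}$ and the Gaussian gates only. We write $\mathrm{ite}_n\colon\mathsf B\,\mathsf R^n\mathsf R^n\to\mathsf R^n$ for the componentwise composite of $n$ $\mathrm{ite}$ gates sharing one guard. **Semantics.** $[\![\cdot]\!]$ is the symmetric monoidal functor to stochastic kernels with $\mathsf B\mapsto\{0,1\}$, $\mathsf R\mapsto\mathbb R$ that sends $\mathrm{flip}_p$ to the Bernoulli law with probability $p$ of $1$, $\mathrm N$ to the standard normal law $\mathcal N(0,1)$, $\mathrm{ite}$ to the deterministic map with $(1,x,y)\mapsto x$, $(0,x,y)\mapsto y$, and the remaining generators to the deterministic maps that they denote. **Theory.** $=_{\mathsf{CGM}}$ is the smallest congruence for sequential and parallel composition on circuits that contains all equations $c=d$ with $[\![c]\!]=[\![d]\!]$ where $c,d$ are both Boolean or both Gaussian (the two fragments are taken with complete theories), and the following equations between circuits, written with variables (a repeated variable on one side is copied, a missing one is discarded): - (A, B) $\mathrm{copy}_a,\mathrm{del}_a$ form a cocommutative comonoid, for $a\in\{\mathsf R,\mathsf B\}$; - (C) the generators $0,1,+,k\cdot,\wedge,\neg$ commute with copying; (D) these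 and $\mathrm{flip}_p$ commute with discarding; - (E1) $\mathrm{ite}(b,\mathrm{ite}(b,x,y),z)=\mathrm{ite}(b,x,z)=\mathrm{ite}(b,x,\mathrm{ite}(b,y,z))$; - (E2) $\mathrm{ite}(\mathrm{flip}_1,x,y)=x$ and $\mathrm{ite}(\mathrm{flip}_0,x,y)=y$; - (E3) $\mathrm{ite}(a,\mathrm{ite}(b,x,y),\mathrm{ite}(b,z,t))=\mathrm{ite}(b,\mathrm{ite}(a,x,z),\mathrm{ite}(a,y,t))$; - (E4) for all circuits $c,d\colon\mathsf R\,\mathsf R^k\to\mathsf R^n$, if one sample of $\mathrm N$ is copied and fed to the first input of both $c$ and $d$ in $\mathrm{ite}_n(b,c(\cdot,y),d(\cdot,y))$, the result equals that with an independent sample of $\mathrm N$ for each of $c$ and $d$; - (E5) $\mathrm{ite}_n(b,c(x),c(y))=c(\mathrm{ite}_m(b,x,y))$ for every circuit $c\colon\mathsf R^m\to\mathsf R^n$; - (E6) $\mathrm{ite}(\neg b,x,y)=\mathrm{ite}(b,y,x)$; (E7) $\mathrm{ite}(a\wedge b,x,y)=\mathrm{ite}(a,\mathrm{ite}(b,x,y),y)$;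 - (E8) $\mathrm{ite}(b,x,x)=x$; (E9) discarding the output of $\mathrm{ite}$ equals discarding its three inputs; - (E10) $\mathrm{ite}(\mathrm{flip}_q,\mathrm{ite}(\mathrm{flip}_p,x,y),z)=\mathrm{ite}(\mathrm{flip}_{\tilde p},x,\mathrm{ite}(\mathrm{flip}_{\tilde q},y,z))$ where $\tilde p=pq\neq1$ and $\tilde q=\frac{q(1-p)}{1-pq}$. **Convex normal form.** The circuits $\mathsf R^m\to\mathsf R^n$ in convex normal form (CNF) are defined inductively: every Gaussian circuit is in CNF; and if $c,c'\colon\mathsf R^m\to\mathsf R^n$ are in CNF and $p\in(0,1)$, then the circuit $x\mapsto\mathrm{ite}_n(\mathrm{flip}_p,c(x),c'(x))$, where $x\in\mathsf R^m$ is copied, is in CNF. (In particular, this covers the right-nested mixtures, where $c$ is Gaussian at every step.) **Proposition.** Let $m,n\ge0$ and let $c,d\colon\mathsf R^m\to\mathsf R^n$ be circuits in convex normal form with $[\![c]\!]=[\![d]\!]$. Then $c=_{\mathsf{CGM}}d$. -/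

import Mathlib

open MeasureTheory ProbabilityTheory

namespace CGM

/-! ### Syntax: the two-coloured prop of mixed circuits -/

/-- The two colours: Boolean wires `B` and real wires `R`. -/
inductive Col
  | B
  | R

open Col

/-- The word `B^p`. -/
abbrev Bw (p : ℕ) : List Col := List.replicate p B

/-- The word `R^n`. -/
abbrev Rw (n : ℕ) : List Col := List.replicate n R

/-- The generators, typed by their input and output words.
`copy`, `del` exist for both colours; `flip p` is a biased coin; `zero`, `add`, `scal k`, `one` are
the affine operations on reals, `nn` is a standard normal sample;
`ifte` is the if-then-else gate (guard, then-branch, else-branch). -/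
inductive Gen : List Col → List Col → Type
  | copy (a : Col) : Gen [a] [a, a]
  | del (a : Col) : Gen [a] []
  | andg : Gen [B, B] [B]
  | notg : Gen [B] [B]
  | flip (p : unitInterval) : Gen [] [B]
  | zero : Gen [] [R]
  | add : Gen [R, R] [R]
  | scal (k : ℝ) : Gen [R] [R]
  | one : Gen [] [R]
  | nn : Gen [] [R]
  | ifte : Gen [B, R, R] [R]

/-- Generators of the (probabilistic) Boolean fragment. -/
def Gen.IsBool {v w : List Col} : Gen v w → Prop
  | .copy B | .del B | .andg | .notg | .flip _ => True
  | _ => False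

/-- Generators of the Gaussian fragment. -/
def Gen.IsGauss {v w : List Col} : Gen v w → Prop
  | .copy R | .del R | .zero | .add | .scal _ | .one | .nn => True
  | _ => False

/-- Terms for circuits `v → w`: generators, identities and symmetries, composed sequentially and in
parallel. Circuits are such terms up to the laws of strict symmetric monoidal categories, see
`SMCEq` below. -/
inductive Circ : List Col → List Col → Type
  | gen {v w : List Col} (g : Gen v w) : Circ v w
  | idw (v : List Col) : Circ v v
  | swap (v w : List Col) : Circ (v ++ w) (w ++ v)
  | seq {u v w : List Col} (c : Circ u v) (d : Circ v w) : Circ u w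
  | par {v w v' w' : List Col} (c : Circ v w) (d : Circ v' w') : Circ (v ++ v') (w ++ w')

namespace Circ

scoped notation:65 c:65 " ⨟ " d:66 => Circ.seq (c :) (d :)
scoped notation:70 c:71 " ⊠ " d:70 => (Circ.par (c :) (d :) :)

/-- Transport of a circuit along equalities of words. -/
def cast {v w v' w' : List Col} (hv : v = v') (hw : w = w') (c : Circ v w) : Circ v' w' :=
  hv ▸ hw ▸ c

/-- All generators of the circuit are Boolean. -/
def IsBool {v w : List Col} : Circ v w → Prop
  | gen g => g.IsBool
  | idw _ => True
  | swap _ _ => True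
  | seq c d => c.IsBool ∧ d.IsBool
  | par c d => c.IsBool ∧ d.IsBool

/-- All generators of the circuit are Gaussian. -/
def IsGauss {v w : List Col} : Circ v w → Prop
  | gen g => g.IsGauss
  | idw _ => True
  | swap _ _ => True
  | seq c d => c.IsGauss ∧ d.IsGauss
  | par c d => c.IsGauss ∧ d.IsGauss

/-! ### Derived circuits -/

abbrev copy (a : Col) : Circ [a] [a, a] := gen (.copy a)
abbrev del (a : Col) : Circ [a] [] := gen (.del a)
abbrev andg : Circ [B, B] [B] := gen .andg
abbrev notg : Circ [B] [B] := gen .notg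
abbrev flip (p : unitInterval) : Circ [] [B] := gen (.flip p)
abbrev nn : Circ [] [R] := gen .nn
abbrev ifte : Circ [B, R, R] [R] := gen .ifte

/-- Discarding all wires of a word. -/
def delW : (v : List Col) → Circ v []
  | [] => idw []
  | a :: v => del a ⊠ delW v

/-- Copying all wires of a word: `v ↦ v v`. -/
def copyW : (v : List Col) → Circ v (v ++ v)
  | [] => idw []
  | a :: v =>
    (copy a ⊠ copyW v) ⨟ cast (v' := a :: a :: (v ++ v)) (w' := a :: (v ++ a :: v)) rfl (by simp)
        (idw [a] ⊠ swap [a] v ⊠ idw v)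

/-- The `n`-ary if-then-else circuit `B R^n R^n → R^n`: `n` if-then-else gates that share a single
guard (so for `n = 0` the guard is discarded, and for `n = 1` it is the gate itself). -/
def ifteW : (n : ℕ) → Circ (B :: (Rw n ++ Rw n)) (Rw n)
  | 0 => del B
  | 1 => ifte
  | n + 2 =>
    (copy B ⊠ idw (Rw (n + 2) ++ Rw (n + 2)))
      ⨟ (idw [B] ⊠ swap [B] [R] ⊠ idw (Rw (n + 1) ++ Rw (n + 2)))
      ⨟ cast (v' := B :: R :: B :: (Rw (n + 1) ++ Rw (n + 2))) (by simp [List.replicate_succ]) rfl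
          (idw [B, R] ⊠ swap (B :: Rw (n + 1)) [R] ⊠ idw (Rw (n + 1)))
      ⨟ (ifte ⊠ ifteW (n + 1))

/-- The `p`-mixture of `c` and `d`: copy the input, run `c` and `d` in parallel and select the
output of `c` or of `d` by an if-then-else whose guard is `flip p`. -/
def mix {m n : ℕ} (p : unitInterval) (c d : Circ (Rw m) (Rw n)) : Circ (Rw m) (Rw n) :=
  copyW (Rw m) ⨟ (flip p ⊠ c ⊠ d) ⨟ ifteW n

end Circ

/-! ### Semantics: stochastic kernels -/

/-- Values carried by a wire. -/
def Col.Ty : Col → Type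
  | B => Bool
  | R => ℝ

instance : (a : Col) → MeasurableSpace a.Ty
  | B => inferInstanceAs (MeasurableSpace Bool)
  | R => inferInstanceAs (MeasurableSpace ℝ)

/-- Values carried by a word of wires; up to reordering, `Val v` is `𝔹^p × ℝ^m` where `p` and `m` are
the numbers of Boolean and real wires of `v`. -/
def Val : List Col → Type
  | [] => Unit
  | a :: v => a.Ty × Val v

instance instMeasurableSpaceVal : (v : List Col) → MeasurableSpace (Val v)
  | [] => inferInstanceAs (MeasurableSpace Unit)
  | a :: v =>
    letI := instMeasurableSpaceVal v
    inferInstanceAs (MeasurableSpace (a.Ty × Val v))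

/-- Splitting the values of a concatenated word. -/
def Val.split : (v w : List Col) → Val (v ++ w) ≃ᵐ Val v × Val w
  | [], w => (MeasurableEquiv.punitProd (α := Val w)).symm
  | a :: v, w =>
    ((MeasurableEquiv.refl a.Ty).prodCongr (Val.split v w)).trans
      (MeasurableEquiv.prodAssoc (α := a.Ty) (β := Val v) (γ := Val w)).symm

/-- The law of a coin that is true with probability `p`. -/
noncomputable def coin (p : unitInterval) : Measure Bool :=
  ENNReal.ofReal p • Measure.dirac true + ENNReal.ofReal (1 - p) • Measure.dirac false

/-- Interpretation of the generators. -/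
noncomputable def Gen.sem : {v w : List Col} → Gen v w → Kernel (Val v) (Val w)
  | _, _, .copy a =>
    (Kernel.deterministic (fun x => (x.1, x.1, ())) (by fun_prop) :
      Kernel (a.Ty × Unit) (a.Ty × a.Ty × Unit))
  | _, _, .del a =>
    (Kernel.deterministic (fun _ => ()) (by fun_prop) : Kernel (a.Ty × Unit) Unit)
  | _, _, .andg =>
    (Kernel.deterministic (fun x => (x.1 && x.2.1, ())) (measurable_of_countable _) :
      Kernel (Bool × Bool × Unit) (Bool × Unit))
  | _, _, .notg =>
    (Kernel.deterministic (fun x => (!x.1, ())) (measurable_of_countable _) :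
      Kernel (Bool × Unit) (Bool × Unit))
  | _, _, .flip p =>
    (Kernel.const Unit ((coin p).map fun b => (b, ())) : Kernel Unit (Bool × Unit))
  | _, _, .zero =>
    (Kernel.deterministic (fun _ => (0, ())) (by fun_prop) : Kernel Unit (ℝ × Unit))
  | _, _, .add =>
    (Kernel.deterministic (fun x => (x.1 + x.2.1, ())) (by fun_prop) :
      Kernel (ℝ × ℝ × Unit) (ℝ × Unit))
  | _, _, .scal k =>
    (Kernel.deterministic (fun x => (k * x.1, ())) (by fun_prop) : Kernel (ℝ × Unit) (ℝ × Unit))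
  | _, _, .one =>
    (Kernel.deterministic (fun _ => (1, ())) (by fun_prop) : Kernel Unit (ℝ × Unit))
  | _, _, .nn =>
    (Kernel.const Unit ((gaussianReal 0 1).map fun x => (x, ())) : Kernel Unit (ℝ × Unit))
  | _, _, .ifte =>
    (Kernel.deterministic (fun x => (if x.1 = true then x.2.1 else x.2.2.1, ()))
      ((Measurable.ite (measurable_fst (measurableSet_singleton true))
        (by fun_prop) (by fun_prop)).prodMk measurable_const) :
      Kernel (Bool × ℝ × ℝ × Unit) (ℝ × Unit))

/-- Interpretation of circuits: sequential composition is composition of kernels, parallel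
composition is the product of kernels. -/
noncomputable def Circ.sem : {v w : List Col} → Circ v w → Kernel (Val v) (Val w)
  | _, _, .gen g => g.sem
  | _, _, .idw _ => Kernel.id
  | _, _, .swap v w =>
    Kernel.deterministic (fun x => (Val.split w v).symm (Val.split v w x).swap) (by fun_prop)
  | _, _, .seq c d => d.sem ∘ₖ c.sem
  | _, _, @Circ.par v w v' w' c d =>
    ((c.sem ∥ₖ d.sem).comap (Val.split v v') (by fun_prop)).map (Val.split w w').symm

/-! ### Equational theories -/

open scoped CGM.Circ
open Circ

/-- `Eqv Ax c d`: the equality `c = d` is derivable from the laws of strict symmetric monoidal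
categories and the equations `Ax`. The relation is heterogeneous, since the two sides of
the associativity and unit laws have types that are equal but not definitionally so. -/
inductive Eqv (Ax : ∀ ⦃v w : List Col⦄, Circ v w → Circ v w → Prop) :
    ∀ {v w v' w' : List Col}, Circ v w → Circ v' w' → Prop
  | ax {v w} {c d : Circ v w} : Ax c d → Eqv Ax c d
  | refl {v w} (c : Circ v w) : Eqv Ax c c
  | symm {v w v' w'} {c : Circ v w} {d : Circ v' w'} : Eqv Ax c d → Eqv Ax d c
  | trans {v w v' w' v'' w''} {c : Circ v w} {d : Circ v' w'} {e : Circ v'' w''} :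
      Eqv Ax c d → Eqv Ax d e → Eqv Ax c e
  | seq_congr {u v w u' v' w'} {c : Circ u v} {d : Circ v w} {c' : Circ u' v'} {d' : Circ v' w'} :
      Eqv Ax c c' → Eqv Ax d d' → Eqv Ax (c ⨟ d) (c' ⨟ d')
  | par_congr {v₁ w₁ v₂ w₂ v₁' w₁' v₂' w₂'} {c : Circ v₁ w₁} {d : Circ v₂ w₂}
      {c' : Circ v₁' w₁'} {d' : Circ v₂' w₂'} :
      Eqv Ax c c' → Eqv Ax d d' → Eqv Ax (c ⊠ d) (c' ⊠ d')
  | seq_assoc {u v w x} (c : Circ u v) (d : Circ v w) (e : Circ w x) :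
      Eqv Ax ((c ⨟ d) ⨟ e) (c ⨟ (d ⨟ e))
  | id_seq {v w} (c : Circ v w) : Eqv Ax (idw v ⨟ c) c
  | seq_id {v w} (c : Circ v w) : Eqv Ax (c ⨟ idw w) c
  | par_assoc {v₁ w₁ v₂ w₂ v₃ w₃} (c : Circ v₁ w₁) (d : Circ v₂ w₂) (e : Circ v₃ w₃) :
      Eqv Ax ((c ⊠ d) ⊠ e) (c ⊠ (d ⊠ e))
  | nil_par {v w} (c : Circ v w) : Eqv Ax (idw [] ⊠ c) c
  | par_nil {v w} (c : Circ v w) : Eqv Ax (c ⊠ idw []) c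
  | id_par_id (v w) : Eqv Ax (idw v ⊠ idw w) (idw (v ++ w))
  | interchange {u v w u' v' w'} (c : Circ u v) (d : Circ v w) (c' : Circ u' v') (d' : Circ v' w') :
      Eqv Ax ((c ⊠ c') ⨟ (d ⊠ d')) ((c ⨟ d) ⊠ (c' ⨟ d'))
  | swap_natural {v w v' w'} (c : Circ v w) (d : Circ v' w') :
      Eqv Ax ((c ⊠ d) ⨟ swap w w') (swap v v' ⨟ (d ⊠ c))
  | swap_swap (v w) : Eqv Ax (swap v w ⨟ swap w v) (idw (v ++ w))
  | swap_nil (v) : Eqv Ax (swap v []) (idw v)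
  | hexagon (u v w) :
      Eqv Ax (swap u (v ++ w))
        ((swap u v ⊠ idw w) ⨟ cast (v' := (v ++ u) ++ w) (by simp) rfl (idw v ⊠ swap u w))

/-- Equality of terms up to the laws of symmetric monoidal categories: two terms denote the same
circuit (morphism of the free prop). -/
def SMCEq {v w : List Col} (c d : Circ v w) : Prop := Eqv (fun _ _ _ _ => False) c d

/-- The generators that can be copied by an axiom. -/
def Gen.Copyable {v w : List Col} : Gen v w → Prop
  | .zero | .add | .scal _ | .one | .andg | .notg => True
  | _ => False

/-- The generators that can be discarded by an axiom. -/
def Gen.Discardable {v w : List Col} : Gen v w → Prop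
  | .zero | .add | .scal _ | .one | .andg | .notg | .flip _ => True
  | _ => False

/-- `(a, b, x, y, z, t) ↦ ifte a (ifte b x y) (ifte b z t)`. -/
def Circ.nested : Circ [B, B, R, R, R, R] [R] :=
  (idw [B] ⊠ copy B ⊠ idw [R, R, R, R]) ⨟ (idw [B, B] ⊠ swap [B] [R, R] ⊠ idw [R, R])
    ⨟ (idw [B] ⊠ ifte ⊠ ifte) ⨟ ifte

/-- The equations of the theory of conditional Gaussian mixtures. The two fragments come with
complete equational theories of their own, entering as `bool` and `gauss`: the valid equations between
Boolean circuits and between Gaussian circuits. -/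
inductive Ax : ∀ ⦃v w : List Col⦄, Circ v w → Circ v w → Prop
  | bool {p q : ℕ} (c d : Circ (Bw p) (Bw q)) :
      c.IsBool → d.IsBool → c.sem = d.sem → Ax c d
  | gauss {m n : ℕ} (c d : Circ (Rw m) (Rw n)) :
      c.IsGauss → d.IsGauss → c.sem = d.sem → Ax c d
  -- copying and discarding form a commutative comonoid, for both colours
  | copy_assoc (a : Col) : Ax (copy a ⨟ (copy a ⊠ idw [a])) (copy a ⨟ (idw [a] ⊠ copy a))
  | copy_del_left (a : Col) : Ax (copy a ⨟ (del a ⊠ idw [a])) (idw [a])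
  | copy_del_right (a : Col) : Ax (copy a ⨟ (idw [a] ⊠ del a)) (idw [a])
  | copy_comm (a : Col) : Ax (copy a ⨟ swap [a] [a]) (copy a)
  -- deterministic generators can be copied
  | gen_copy {v w : List Col} (g : Gen v w) : g.Copyable →
      Ax (gen g ⨟ copyW w) (copyW v ⨟ (gen g ⊠ gen g))
  -- generators can be discarded
  | gen_del {v w : List Col} (g : Gen v w) : g.Discardable → Ax (gen g ⨟ delW w) (delW v)
  -- `ifte b (ifte b x y) z = ifte b x z = ifte b x (ifte b y z)`
  | ifte_guard_left : Ax ((copy B ⊠ idw [R, R, R]) ⨟ (idw [B] ⊠ ifte ⊠ idw [R]) ⨟ ifte)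
      ((idw [B, R] ⊠ del R ⊠ idw [R]) ⨟ ifte)
  | ifte_guard_right : Ax ((idw [B, R] ⊠ del R ⊠ idw [R]) ⨟ ifte)
      ((copy B ⊠ idw [R, R, R]) ⨟ (idw [B] ⊠ swap [B] [R] ⊠ idw [R, R]) ⨟ (idw [B, R] ⊠ ifte) ⨟ ifte)
  -- `ifte true x y = x`, `ifte false x y = y`
  | ifte_true : Ax ((flip 1 ⊠ idw [R, R]) ⨟ ifte) (idw [R] ⊠ del R)
  | ifte_false : Ax ((flip 0 ⊠ idw [R, R]) ⨟ ifte) (del R ⊠ idw [R])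
  -- `ifte a (ifte b x y) (ifte b z t) = ifte b (ifte a x z) (ifte a y t)`
  | ifte_ifte : Ax nested ((swap [B] [B] ⊠ idw [R] ⊠ swap [R] [R] ⊠ idw [R]) ⨟ nested)
  -- a normal sample that is shared by two branches may be sampled separately in each of them
  | ifte_nn {k n : ℕ} (c d : Circ (Rw (k + 1)) (Rw n)) :
      Ax ((idw [B] ⊠ ((nn ⊠ idw (Rw k)) ⨟ copyW (Rw (k + 1)) ⨟ (c ⊠ d))) ⨟ ifteW n)
        ((idw [B] ⊠ (copyW (Rw k) ⨟ ((nn ⊠ idw (Rw k)) ⊠ (nn ⊠ idw (Rw k))) ⨟ (c ⊠ d))) ⨟ ifteW n)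
  -- `ifte b (c x) (c y) = c (ifte b x y)`
  | ifte_natural {m n : ℕ} (c : Circ (Rw m) (Rw n)) :
      Ax ((idw [B] ⊠ c ⊠ c) ⨟ ifteW n) (ifteW m ⨟ c)
  -- `ifte (not b) x y = ifte b y x`
  | ifte_not : Ax ((notg ⊠ idw [R, R]) ⨟ ifte) ((idw [B] ⊠ swap [R] [R]) ⨟ ifte)
  -- `ifte (a and b) x y = ifte a (ifte b x y) y`
  | ifte_and : Ax ((andg ⊠ idw [R, R]) ⨟ ifte)
      ((idw [B, B, R] ⊠ copy R) ⨟ (idw [B] ⊠ ifte ⊠ idw [R]) ⨟ ifte)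
  -- `ifte b x x = x`
  | ifte_idem : Ax ((idw [B] ⊠ copy R) ⨟ ifte) (del B ⊠ idw [R])
  | ifte_del : Ax (ifte ⨟ del R) (delW [B, R, R])
  -- skew associativity of convex sums
  | skew_assoc (p q p' q' : unitInterval) : (p * q : ℝ) ≠ 1 → (p' : ℝ) = p * q →
      (q' : ℝ) = q * (1 - p) / (1 - p * q) →
      Ax ((flip q ⊠ flip p ⊠ idw [R, R, R]) ⨟ (idw [B] ⊠ ifte ⊠ idw [R]) ⨟ ifte)
        ((flip p' ⊠ idw [R] ⊠ flip q' ⊠ idw [R, R]) ⨟ (idw [B, R] ⊠ ifte) ⨟ ifte)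

/-- Equality of circuits in the theory of conditional Gaussian mixtures. -/
def CGMEq {v w : List Col} (c d : Circ v w) : Prop := Eqv Ax c d

/-- Convex normal form: a circuit is in convex normal form if it is a Gaussian circuit, or a
`p`-mixture, with `0 < p < 1`, of two circuits in convex normal form. As circuits are
terms up to the laws of symmetric monoidal categories, so is the notion. -/
inductive IsCNF : {m n : ℕ} → Circ (Rw m) (Rw n) → Prop
  | gauss {m n : ℕ} (c : Circ (Rw m) (Rw n)) : c.IsGauss → IsCNF c
  | mix {m n : ℕ} (p : unitInterval) (c d : Circ (Rw m) (Rw n)) : 0 < p → p < 1 →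
      IsCNF c → IsCNF d → IsCNF (Circ.mix p c d)
  | smc {m n : ℕ} (c d : Circ (Rw m) (Rw n)) : SMCEq c d → IsCNF c → IsCNF d

end CGM

/-!
A circuit in convex normal form is an iterated mixture of Gaussian circuits. The proof compares
two such mixtures by their weights, the semantics determining the weights and the equations
determining the circuit from the weights.

*Equations.* Circuits modulo the theory are the morphisms of a symmetric monoidal category on words,
where the empty word is terminal because every circuit can be discarded (`hom_seq_delW`). A normal
sample or a coin cannot be copied, so an equation between circuits cannot be used with
arbitrary circuits for its variables when a variable is repeated. It can be used with
*deterministic* morphisms (`Det`), those that commute with copying, and the projections are among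
them. Laws of `ifteW n` are therefore proved for deterministic arguments, by induction on `n` from
the equations for a single gate, then stated as equations between circuits by evaluating at the
projections (`exists_generic`), and only then composed with arbitrary morphisms. Together with the
valid Boolean equation `andCirc_orCirc_sem`, which rearranges the guards, this shows that the
operation `mixOp p` induced by `mix p` satisfies the laws of a convex algebra: `mixOp_one`,
`mixOp_self`, `mixOp_symm` and `mixOp_skew`.

In a convex algebra, an iterated mixture is determined by the total weight that it gives to each of
its leaves (`IsMix.unique`): any chosen leaf can be collected in front, as in `g +_r a`, and the
remaining mixture `a` has a smaller support.

*Semantics.* The leaves are labelled by their moment generating functions. For a Gaussian circuit with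
input `x` this function is `t ↦ exp (P (x, t))` with a polynomial `P` that vanishes at `0`
(`exists_hasLogMGF`, `HasLogMGF.eval_zero`), and two Gaussian circuits with the same `P` have the
same interpretation (`HasLogMGF.sem_eq`), so they are equal by the completeness of the Gaussian
fragment. The moment generating function of a mixture is the corresponding combination of
exponentials. Exponentials of distinct polynomials that vanish at `0` are linearly independent
(`eq_zero_of_sum_exp_eq_zero`): on a suitable line through `0` the polynomials remain distinct, and
the term that grows fastest along the line cannot be cancelled. Hence two mixtures with the same
interpretation have the same weights. As convex normal forms are closed under the laws of symmetric
monoidal categories, the argument also needs the soundness of these laws (`SMCEq.sem_eq`).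
-/

/-! ### Integration against the semantics -/

namespace CGM

open Col Circ
open scoped CGM.Circ ENNReal

/-- Concatenation of values. -/
def join {v w : List Col} (x : Val v) (y : Val w) : Val (v ++ w) := (Val.split v w).symm (x, y)

theorem split_join {v w : List Col} (x : Val v) (y : Val w) :
    Val.split v w (join x y) = (x, y) := (Val.split v w).apply_symm_apply _

theorem exists_join {v w : List Col} (x : Val (v ++ w)) : ∃ y z, x = join y z :=
  ⟨_, _, ((Val.split v w).symm_apply_apply x).symm⟩

theorem measurable_join {v w : List Col} : Measurable fun p : Val v × Val w => join p.1 p.2 :=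
  (Val.split v w).symm.measurable

instance isProbabilityMeasure_coin (p : unitInterval) : IsProbabilityMeasure (coin p) := by
  refine ⟨?_⟩
  have h := p.2
  simp only [coin, Measure.coe_add, Measure.coe_smul, Pi.add_apply, Pi.smul_apply, measure_univ,
    smul_eq_mul, mul_one]
  rw [← ENNReal.ofReal_add h.1 (by linarith [h.2])]
  simp

instance isMarkovKernel_gen {v w : List Col} (g : Gen v w) : IsMarkovKernel g.sem := by
  cases g with
  | flip p =>
    have : IsProbabilityMeasure ((coin p).map fun b => ((b, ()) : Bool × Unit)) :=
      Measure.isProbabilityMeasure_map (by fun_prop)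
    exact (inferInstance : IsMarkovKernel
      (Kernel.const Unit ((coin p).map fun b => ((b, ()) : Bool × Unit))))
  | nn =>
    have : IsProbabilityMeasure ((gaussianReal 0 1).map fun x => ((x, ()) : ℝ × Unit)) :=
      Measure.isProbabilityMeasure_map (by fun_prop)
    exact (inferInstance : IsMarkovKernel
      (Kernel.const Unit ((gaussianReal 0 1).map fun x => ((x, ()) : ℝ × Unit))))
  | _ =>
    rw [Gen.sem]
    exact Kernel.isMarkovKernel_deterministic _

instance isMarkovKernel_sem {v w : List Col} (c : Circ v w) : IsMarkovKernel c.sem := by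
  induction c with
  | gen g => exact isMarkovKernel_gen g
  | idw v => exact inferInstanceAs (IsMarkovKernel Kernel.id)
  | swap v w => exact Kernel.isMarkovKernel_deterministic _
  | seq c d ihc ihd => exact inferInstanceAs (IsMarkovKernel (d.sem ∘ₖ c.sem))
  | par c d ihc ihd =>
    rw [Circ.sem]
    exact Kernel.IsMarkovKernel.map _ (MeasurableEquiv.measurable _)

theorem lintegral_seq {u v w : List Col} (c : Circ u v) (d : Circ v w) (x : Val u)
    {F : Val w → ℝ≥0∞} (hF : Measurable F) :
    ∫⁻ z, F z ∂(c ⨟ d).sem x = ∫⁻ y, ∫⁻ z, F z ∂d.sem y ∂c.sem x :=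
  Kernel.lintegral_comp d.sem c.sem x hF

theorem par_sem_apply {v w v' w' : List Col} (c : Circ v w) (d : Circ v' w') (x : Val v)
    (x' : Val v') :
    (c ⊠ d).sem (join x x') = ((c.sem x).prod (d.sem x')).map fun p => join p.1 p.2 := by
  rw [Circ.sem, Kernel.map_apply _ (MeasurableEquiv.measurable _), Kernel.comap_apply, split_join,
    Kernel.parallelComp_apply]
  rfl

theorem lintegral_par {v w v' w' : List Col} (c : Circ v w) (d : Circ v' w') (x : Val v)
    (x' : Val v') {F : Val (w ++ w') → ℝ≥0∞} (hF : Measurable F) :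
    ∫⁻ z, F z ∂(c ⊠ d).sem (join x x') = ∫⁻ y, ∫⁻ y', F (join y y') ∂d.sem x' ∂c.sem x := by
  rw [par_sem_apply, lintegral_map hF measurable_join]
  exact lintegral_prod _ (hF.comp measurable_join).aemeasurable

theorem idw_sem_apply (v : List Col) (x : Val v) : (idw v).sem x = Measure.dirac x :=
  Kernel.id_apply x

theorem swap_sem_apply {v w : List Col} (x : Val v) (y : Val w) :
    (swap v w).sem (join x y) = Measure.dirac (join y x) := by
  rw [Circ.sem, Kernel.deterministic_apply, split_join]
  rfl

theorem sem_eq_of_codomain_nil {v : List Col} (c d : Circ v []) : c.sem = d.sem := by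
  ext x s _
  have : Subsingleton (Val []) := inferInstanceAs (Subsingleton Unit)
  obtain rfl | rfl := s.eq_empty_or_nonempty.imp_right Subsingleton.eq_univ_of_nonempty
  · simp
  · rw [measure_univ, measure_univ]

theorem sem_ext {v w : List Col} {c d : Circ v w}
    (h : ∀ x, ∀ F : Val w → ℝ≥0∞, Measurable F → ∫⁻ y, F y ∂c.sem x = ∫⁻ y, F y ∂d.sem x) :
    c.sem = d.sem := by
  ext x s hs
  simpa [lintegral_indicator hs] using h x (s.indicator 1) (measurable_one.indicator hs)

end CGM

/-! ### Three valid equations between Boolean circuits -/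

namespace CGM

open Col Circ
open scoped CGM.Circ ENNReal

theorem seq_sem_dirac {u v w : List Col} {c : Circ u v} {d : Circ v w} {x : Val u} {y : Val v}
    {z : Val w} (hc : c.sem x = Measure.dirac y) (hd : d.sem y = Measure.dirac z) :
    (c ⨟ d).sem x = Measure.dirac z := by
  rw [Circ.sem, Kernel.comp_apply, hc, Measure.dirac_bind (Kernel.measurable _), hd]

theorem par_sem_dirac {v w v' w' : List Col} {c : Circ v w} {d : Circ v' w'} {x : Val v}
    {x' : Val v'} {y : Val w} {y' : Val w'} (hc : c.sem x = Measure.dirac y)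
    (hd : d.sem x' = Measure.dirac y') :
    (c ⊠ d).sem (join x x') = Measure.dirac (join y y') := by
  rw [par_sem_apply, hc, hd, Measure.dirac_prod_dirac]
  exact Measure.map_dirac' measurable_join _

/-- The value of a single Boolean wire. -/
def bval (r : Bool) : Val [B] := ((r, ()) : Bool × Unit)

theorem copy_sem_apply (r : Bool) :
    (copy B).sem (bval r) = Measure.dirac (join (bval r) (bval r)) := by
  rw [Circ.sem, Gen.sem]
  exact Kernel.deterministic_apply _ _

theorem notg_sem_apply (r : Bool) : notg.sem (bval r) = Measure.dirac (bval !r) := by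
  rw [Circ.sem, Gen.sem]
  exact Kernel.deterministic_apply _ _

theorem andg_sem_apply (r s : Bool) :
    andg.sem (join (bval r) (bval s)) = Measure.dirac (bval (r && s)) := by
  rw [Circ.sem, Gen.sem]
  exact Kernel.deterministic_apply _ _

theorem lintegral_coin (p : unitInterval) (f : Bool → ℝ≥0∞) :
    ∫⁻ b, f b ∂coin p = ENNReal.ofReal p * f true + ENNReal.ofReal (1 - p) * f false := by
  rw [coin, lintegral_add_measure, lintegral_smul_measure, lintegral_smul_measure, lintegral_dirac,
    lintegral_dirac, smul_eq_mul, smul_eq_mul]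

theorem lintegral_flip (p : unitInterval) (x : Val []) {F : Val [B] → ℝ≥0∞} (hF : Measurable F) :
    ∫⁻ y, F y ∂(flip p).sem x = ENNReal.ofReal p * F (bval true) +
      ENNReal.ofReal (1 - p) * F (bval false) := by
  have h : (flip p).sem x = (coin p).map bval := by
    rw [Circ.sem, Gen.sem]
    exact Kernel.const_apply _ _
  rw [h, lintegral_map hF (measurable_of_countable _), lintegral_coin]

/-- The circuit `(b, a) ↦ (b ∧ a, b)`. -/
def andCirc : Circ [B, B] [B, B] :=
  (copy B ⊠ idw [B]) ⨟ (idw [B] ⊠ swap [B] [B]) ⨟ (andg ⊠ idw [B])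

/-- The circuit `(g, h) ↦ (g, g ∨ h)`. -/
def orCirc : Circ [B, B] [B, B] :=
  (copy B ⊠ idw [B]) ⨟ (idw [B] ⊠ ((notg ⊠ notg) ⨟ andg ⨟ notg))

theorem andCirc_sem_apply (r s : Bool) :
    andCirc.sem (join (bval r) (bval s)) = Measure.dirac (join (bval (r && s)) (bval r)) := by
  have h1 : (copy B ⊠ idw [B]).sem (join (bval r) (bval s)) =
      Measure.dirac (join (join (bval r) (bval r)) (bval s)) :=
    par_sem_dirac (copy_sem_apply r) (idw_sem_apply _ _)
  have h2 : (idw [B] ⊠ swap [B] [B]).sem (join (bval r) (join (bval r) (bval s))) =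
      Measure.dirac (join (bval r) (join (bval s) (bval r))) :=
    par_sem_dirac (idw_sem_apply _ _) (swap_sem_apply _ _)
  have h3 : (andg ⊠ idw [B]).sem (join (join (bval r) (bval s)) (bval r)) =
      Measure.dirac (join (bval (r && s)) (bval r)) :=
    par_sem_dirac (andg_sem_apply r s) (idw_sem_apply _ _)
  exact seq_sem_dirac (c := (copy B ⊠ idw [B]) ⨟ (idw [B] ⊠ swap [B] [B]))
    (seq_sem_dirac (c := copy B ⊠ idw [B]) h1 h2) h3

theorem orCirc_sem_apply (r s : Bool) :
    orCirc.sem (join (bval r) (bval s)) = Measure.dirac (join (bval r) (bval (r || s))) := by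
  have h1 : (copy B ⊠ idw [B]).sem (join (bval r) (bval s)) =
      Measure.dirac (join (join (bval r) (bval r)) (bval s)) :=
    par_sem_dirac (copy_sem_apply r) (idw_sem_apply _ _)
  have h2 : (notg ⊠ notg).sem (join (bval r) (bval s)) =
      Measure.dirac (join (bval !r) (bval !s)) :=
    par_sem_dirac (notg_sem_apply r) (notg_sem_apply s)
  have h3 : ((notg ⊠ notg) ⨟ andg ⨟ notg).sem (join (bval r) (bval s)) =
      Measure.dirac (bval (r || s)) := by
    have h := seq_sem_dirac (seq_sem_dirac (c := notg ⊠ notg) h2 (andg_sem_apply (!r) (!s)))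
      (notg_sem_apply _)
    rwa [show (!(!r && !s)) = (r || s) by simp] at h
  have h4 : (idw [B] ⊠ ((notg ⊠ notg) ⨟ andg ⨟ notg)).sem
      (join (bval r) (join (bval r) (bval s))) = Measure.dirac (join (bval r) (bval (r || s))) :=
    par_sem_dirac (idw_sem_apply _ _) h3
  exact seq_sem_dirac (c := copy B ⊠ idw [B]) h1 h4

theorem flip_sem_eq_not (p : unitInterval) :
    (flip p).sem = (flip (unitInterval.symm p) ⨟ notg).sem := by
  refine sem_ext fun x F hF => ?_
  rw [lintegral_seq _ _ _ hF, lintegral_flip p x hF, lintegral_flip _ x hF.lintegral_kernel,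
    notg_sem_apply, notg_sem_apply, lintegral_dirac' _ hF, lintegral_dirac' _ hF, add_comm]
  simp

theorem flip_one_copy_sem : (flip 1 ⨟ copy B).sem = (flip 1 ⊠ flip 1).sem := by
  refine sem_ext fun x F hF => ?_
  have h1 : ∀ y : Val [B], Measurable fun z : Val [B] => F (join y z) :=
    fun y => hF.comp (measurable_join.comp measurable_prodMk_left)
  rw [lintegral_seq _ _ _ hF, lintegral_flip _ x hF.lintegral_kernel]
  erw [lintegral_par (flip 1) (flip 1) x x hF]
  rw [lintegral_flip]
  · rw [lintegral_flip _ _ (h1 _), copy_sem_apply, lintegral_dirac' _ hF]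
    simp
  · exact Measurable.lintegral_prod_right (hF.comp measurable_join)

theorem lintegral_flip_par (p q : unitInterval) (x : Val []) {F : Val [B, B] → ℝ≥0∞}
    (hF : Measurable F) :
    ∫⁻ y, F y ∂(flip p ⊠ flip q).sem x =
      ENNReal.ofReal p * (ENNReal.ofReal q * F (join (bval true) (bval true)) +
        ENNReal.ofReal (1 - q) * F (join (bval true) (bval false))) +
      ENNReal.ofReal (1 - p) *
        (ENNReal.ofReal q * F (join (bval false) (bval true)) +
        ENNReal.ofReal (1 - q) * F (join (bval false) (bval false))) := by
  have h1 : ∀ y : Val [B], Measurable fun z : Val [B] => F (join y z) :=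
    fun y => hF.comp (measurable_join.comp measurable_prodMk_left)
  erw [lintegral_par (flip p) (flip q) x x hF]
  rw [lintegral_flip, lintegral_flip _ _ (h1 _), lintegral_flip _ _ (h1 _)]
  exact Measurable.lintegral_prod_right (hF.comp measurable_join)

/-- Two ways of choosing between three alternatives: the guards `(b ∧ a, b)` with `b, a` of
probabilities `q, p` have the same joint law as the guards `(g, g ∨ h)` with `g, h` of
probabilities `p', q'`. -/
theorem andCirc_orCirc_sem {p q p' q' : unitInterval} (h₁ : (p' : ℝ) = p * q)
    (h₂ : (q : ℝ) * (1 - p) = q' * (1 - p')) :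
    ((flip q ⊠ flip p) ⨟ andCirc).sem = ((flip p' ⊠ flip q') ⨟ orCirc).sem := by
  refine sem_ext fun x F hF => ?_
  rw [lintegral_seq _ _ _ hF, lintegral_seq _ _ _ hF]
  erw [lintegral_flip_par q p x hF.lintegral_kernel, lintegral_flip_par p' q' x hF.lintegral_kernel]
  simp only [andCirc_sem_apply, orCirc_sem_apply, lintegral_dirac' _ hF, Bool.and_true,
    Bool.and_false, Bool.or_false, Bool.or_true]
  generalize F (join (bval true) (bval true)) = A
  generalize F (join (bval false) (bval true)) = C
  generalize F (join (bval false) (bval false)) = D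
  have hp := p.2
  have hq := q.2
  have hp' := p'.2
  have hq' := q'.2
  have e1 : ENNReal.ofReal p' = ENNReal.ofReal q * ENNReal.ofReal p := by
    rw [h₁, ← ENNReal.ofReal_mul hq.1, mul_comm]
  have e2 : ENNReal.ofReal q * ENNReal.ofReal (1 - p) =
      ENNReal.ofReal (1 - p') * ENNReal.ofReal q' := by
    rw [← ENNReal.ofReal_mul hq.1, h₂, mul_comm, ENNReal.ofReal_mul (by linarith [hp'.2])]
  have e3 : ENNReal.ofReal (1 - q) = ENNReal.ofReal (1 - p') * ENNReal.ofReal (1 - q') := by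
    rw [← ENNReal.ofReal_mul (by linarith [hp'.2])]
    congr 1
    rw [mul_sub, mul_one, mul_comm _ (q' : ℝ), ← h₂, h₁]
    ring
  have s1 (r : unitInterval) : ENNReal.ofReal r + ENNReal.ofReal (1 - r) = 1 := by
    rw [← ENNReal.ofReal_add r.2.1 (by linarith [r.2.2])]
    simp
  calc _ = (ENNReal.ofReal q * ENNReal.ofReal p) * A +
        (ENNReal.ofReal q * ENNReal.ofReal (1 - p)) * C +
        ENNReal.ofReal (1 - q) * (ENNReal.ofReal p + ENNReal.ofReal (1 - p)) * D := by ring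
    _ = ENNReal.ofReal p' * (ENNReal.ofReal q' + ENNReal.ofReal (1 - q')) * A +
        (ENNReal.ofReal (1 - p') * ENNReal.ofReal q') * C +
        (ENNReal.ofReal (1 - p') * ENNReal.ofReal (1 - q')) * D := by
      rw [s1, s1, e1, e2, e3, mul_one, mul_one]
    _ = _ := by ring

end CGM

/-! ### The symmetric monoidal category of circuits modulo the theory -/

namespace CGM

open Col Circ CategoryTheory MonoidalCategory
open scoped CGM.Circ

section EqvLemmas

variable {A : ∀ ⦃v w : List Col⦄, Circ v w → Circ v w → Prop}

theorem Eqv.cast_left {v w v' w' : List Col} (hv : v = v') (hw : w = w') (c : Circ v w) :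
    Eqv A (c.cast hv hw) c := by
  subst hv hw
  exact .refl c

end EqvLemmas

/-- Circuits up to equality in the theory. -/
instance circSetoid (v w : List Col) : Setoid (Circ v w) where
  r c d := CGMEq c d
  iseqv := ⟨Eqv.refl, Eqv.symm, Eqv.trans⟩

/-- The category whose objects are words and whose morphisms are circuits modulo the theory. -/
instance : Category (List Col) where
  Hom v w := Quotient (circSetoid v w)
  id v := ⟦idw v⟧
  comp := Quotient.map₂ Circ.seq fun _ _ h _ _ h' => Eqv.seq_congr h h'
  id_comp := by rintro _ _ ⟨c⟩; exact Quotient.sound (Eqv.id_seq c)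
  comp_id := by rintro _ _ ⟨c⟩; exact Quotient.sound (Eqv.seq_id c)
  assoc := by rintro _ _ _ _ ⟨c⟩ ⟨d⟩ ⟨e⟩; exact Quotient.sound (Eqv.seq_assoc c d e)

/-- The morphism denoted by a circuit. -/
def hom {v w : List Col} (c : Circ v w) : v ⟶ w := Quotient.mk (circSetoid v w) c

theorem hom_eq_iff {v w : List Col} {c d : Circ v w} : hom c = hom d ↔ CGMEq c d :=
  ⟨fun h => Quotient.exact h, fun h => Quotient.sound h⟩

theorem exists_hom {v w : List Col} (f : v ⟶ w) : ∃ c : Circ v w, f = hom c := by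
  obtain ⟨c, rfl⟩ := Quotient.exists_rep f
  exact ⟨c, rfl⟩

theorem hom_seq {u v w : List Col} (c : Circ u v) (d : Circ v w) :
    hom (c ⨟ d) = hom c ≫ hom d := rfl

theorem hom_cast {v w v' w' : List Col} (hv : v = v') (hw : w = w') (c : Circ v w) :
    hom (c.cast hv hw) = eqToHom hv.symm ≫ hom c ≫ eqToHom hw := by
  subst hv hw
  simp
  rfl

theorem hom_eq_of_eqv {v w v' w' : List Col} {c : Circ v w} {d : Circ v' w'}
    (h : Eqv Ax c d) (hv : v = v') (hw : w = w') :
    hom c = eqToHom hv ≫ hom d ≫ eqToHom hw.symm := by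
  subst hv hw
  simpa using hom_eq_iff.2 h

theorem hom_par_congr {v w v' w' : List Col} {c c' : Circ v w} {d d' : Circ v' w'}
    (h : hom c = hom c') (h' : hom d = hom d') : hom (c ⊠ d) = hom (c' ⊠ d') :=
  hom_eq_iff.2 (.par_congr (hom_eq_iff.1 h) (hom_eq_iff.1 h'))

/-- Words with concatenation: a monoidal category whose coherence isomorphisms are identities up
to the transport along equalities of words. -/
instance : MonoidalCategoryStruct (List Col) where
  tensorObj v w := v ++ w
  tensorHom f g := Quotient.map₂ Circ.par (fun _ _ h _ _ h' => Eqv.par_congr h h') f g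
  whiskerLeft v _ _ f := Quotient.map (Circ.par (idw v)) (fun _ _ h => Eqv.par_congr (.refl _) h) f
  whiskerRight f w := Quotient.map (fun c => Circ.par c (idw w))
    (fun _ _ h => Eqv.par_congr h (.refl _)) f
  tensorUnit := []
  associator u v w := eqToIso (List.append_assoc u v w)
  leftUnitor v := eqToIso (List.nil_append v)
  rightUnitor v := eqToIso (List.append_nil v)

theorem hom_par {v w v' w' : List Col} (c : Circ v w) (d : Circ v' w') :
    hom (c ⊠ d) = hom c ⊗ₘ hom d := rfl

theorem associator_hom_eq (u v w : List Col) :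
    (α_ u v w).hom = eqToHom (List.append_assoc u v w) := rfl

theorem associator_inv_eq (u v w : List Col) :
    (α_ u v w).inv = eqToHom (List.append_assoc u v w).symm := rfl

theorem leftUnitor_hom_eq (v : List Col) : (λ_ v).hom = 𝟙 v := rfl

theorem rightUnitor_hom_eq (v : List Col) :
    (ρ_ v).hom = eqToHom (List.append_nil v) := rfl

theorem id_tensor_eqToHom {v w u : List Col} (h : v = w) :
    (𝟙 u ⊗ₘ eqToHom h : u ⊗ v ⟶ u ⊗ w) = eqToHom (congrArg (u ++ ·) h) := by
  subst h
  exact Quotient.sound (Eqv.id_par_id u v)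

theorem eqToHom_tensor_id {v w u : List Col} (h : v = w) :
    (eqToHom h ⊗ₘ 𝟙 u : v ⊗ u ⟶ w ⊗ u) = eqToHom (congrArg (· ++ u) h) := by
  subst h
  exact Quotient.sound (Eqv.id_par_id v u)

instance : MonoidalCategory (List Col) := .ofTensorHom
  (id_tensorHom_id := fun v w => Quotient.sound (Eqv.id_par_id v w))
  (id_tensorHom := by rintro v _ _ ⟨c⟩; rfl)
  (tensorHom_id := by rintro _ _ ⟨c⟩ w; rfl)
  (tensorHom_comp_tensorHom := by
    rintro _ _ _ _ _ _ ⟨f⟩ ⟨f'⟩ ⟨g⟩ ⟨g'⟩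
    exact Quotient.sound (Eqv.interchange f g f' g'))
  (associator_naturality := by
    rintro _ _ _ _ _ _ ⟨f⟩ ⟨g⟩ ⟨h⟩
    have := hom_eq_of_eqv (Eqv.par_assoc (Ax := Ax) f g h) (by simp) (by simp)
    change hom ((f ⊠ g) ⊠ h) ≫ eqToHom (List.append_assoc _ _ _) =
      eqToHom (List.append_assoc _ _ _) ≫ hom (f ⊠ (g ⊠ h))
    rw [this]
    simp)
  (leftUnitor_naturality := by
    rintro _ _ ⟨f⟩
    change hom (idw [] ⊠ f) ≫ 𝟙 _ = 𝟙 _ ≫ hom f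
    rw [Category.comp_id, Category.id_comp]
    exact Quotient.sound (Eqv.nil_par f))
  (rightUnitor_naturality := by
    rintro _ _ ⟨f⟩
    have := hom_eq_of_eqv (Eqv.par_nil (Ax := Ax) f) (by simp) (by simp)
    change hom (f ⊠ idw []) ≫ eqToHom (List.append_nil _) = eqToHom (List.append_nil _) ≫ hom f
    rw [this]
    simp)
  (pentagon := by
    intro u v w x
    simp only [associator_hom_eq]
    erw [id_tensor_eqToHom, eqToHom_tensor_id]
    simp only [eqToHom_trans])
  (triangle := by
    intro u v
    simp only [associator_hom_eq, leftUnitor_hom_eq, rightUnitor_hom_eq]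
    erw [id_tensor_eqToHom (rfl : v = v), eqToHom_tensor_id]
    simp only [eqToHom_trans])

theorem whiskerLeft_eqToHom (u : List Col) {v w : List Col} (h : v = w) :
    u ◁ eqToHom h = eqToHom (congrArg (u ++ ·) h) := by
  subst h; simp; rfl

/-- The symmetry, as an isomorphism. -/
def braidIso (v w : List Col) : v ⊗ w ≅ w ⊗ v where
  hom := hom (swap v w)
  inv := hom (swap w v)
  hom_inv_id := hom_eq_iff.2 (.swap_swap v w)
  inv_hom_id := hom_eq_iff.2 (.swap_swap w v)

theorem braidIso_hexagon (u v w : List Col) :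
    α_ u v w ≪≫ braidIso u (v ⊗ w) ≪≫ α_ v w u =
      whiskerRightIso (braidIso u v) w ≪≫ α_ v u w ≪≫ whiskerLeftIso v (braidIso u w) := by
  ext
  have := hom_eq_of_eqv (Eqv.hexagon (Ax := Ax) u v w) (by simp) (by simp)
  rw [hom_seq, hom_cast] at this
  simp only [Iso.trans_hom, whiskerRightIso_hom, whiskerLeftIso_hom, associator_hom_eq]
  change _ ≫ hom (swap u (v ++ w)) ≫ _ = hom (swap u v ⊠ idw w) ≫ _ ≫ hom (idw v ⊠ swap u w)
  rw [this]
  simp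

instance : SymmetricCategory (List Col) where
  braiding := braidIso
  braiding_naturality_right := by
    rintro u _ _ ⟨f⟩
    exact hom_eq_iff.2 (.swap_natural (idw u) f)
  braiding_naturality_left := by
    rintro _ _ ⟨f⟩ w
    exact hom_eq_iff.2 (.swap_natural f (idw w))
  hexagon_forward u v w := congrArg Iso.hom (braidIso_hexagon u v w)
  hexagon_reverse u v w := by
    have := congrArg Iso.inv (braidIso_hexagon w u v)
    simp only [Iso.trans_inv, whiskerRightIso_inv, whiskerLeftIso_inv, Category.assoc] at this
    exact this
  symmetry v w := hom_eq_iff.2 (.swap_swap v w)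

theorem hom_swap (v w : List Col) : hom (swap v w) = (β_ v w).hom := rfl

end CGM

/-! ### Discarding: the empty word is terminal -/

namespace CGM

open Col Circ CategoryTheory MonoidalCategory
open scoped CGM.Circ

theorem hom_delW_singleton (a : Col) : hom (delW [a]) = hom (del a) :=
  hom_eq_iff.2 (.par_nil (del a))

theorem hom_delW_append (v w : List Col) : hom (delW (v ++ w)) = hom (delW v ⊠ delW w) := by
  induction v with
  | nil => exact hom_eq_iff.2 (.symm (.nil_par _))
  | cons a v ih =>
    exact hom_eq_iff.2 (.trans (.par_congr (.refl (del a)) (hom_eq_iff.1 ih))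
      (.symm (.par_assoc (del a) (delW v) (delW w))))

theorem eqv_ax {v w : List Col} {c d : Circ v w} (h : Ax c d) : hom c = hom d :=
  hom_eq_iff.2 (.ax h)

/-- A normal sample can be discarded: both sides are Gaussian circuits without outputs. -/
theorem gauss_nn_del : hom (nn ⨟ delW [R]) = hom (delW []) := by
  refine eqv_ax (Ax.gauss (m := 0) (n := 0) (nn ⨟ delW [R]) (delW []) ?_ ?_ ?_)
  · exact ⟨trivial, trivial, trivial⟩
  · trivial
  · exact sem_eq_of_codomain_nil _ _

theorem gen_seq_delW {v w : List Col} (g : Gen v w) :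
    hom (gen g ⨟ delW w) = hom (delW v) := by
  cases g with
  | copy a =>
    have h : hom (copy a ⨟ (del a ⊠ idw [a])) = 𝟙 [a] := eqv_ax (.copy_del_left a)
    have h1 : CGMEq (delW [a, a]) ((del a ⊠ idw [a]) ⨟ delW [a]) := by
      refine .trans (.par_congr (.symm (.seq_id (del a))) (.symm (.id_seq (delW [a])))) ?_
      refine .trans (.symm (.interchange (del a) (idw []) (idw [a]) (delW [a]))) ?_
      exact .seq_congr (.refl _) (.nil_par _)
    rw [hom_seq, hom_eq_iff.2 h1, hom_seq, ← Category.assoc, ← hom_seq, h, Category.id_comp]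
  | del a =>
    rw [hom_delW_singleton]
    exact hom_eq_iff.2 (.seq_id _)
  | nn => exact gauss_nn_del
  | ifte =>
    have := eqv_ax .ifte_del
    rwa [hom_seq, ← hom_delW_singleton, ← hom_seq] at this
  | _ => exact eqv_ax (.gen_del _ trivial)

/-- Every circuit can be discarded. -/
theorem hom_seq_delW {v w : List Col} (c : Circ v w) : hom c ≫ hom (delW w) = hom (delW v) := by
  induction c with
  | gen g => exact gen_seq_delW g
  | idw v => exact Category.id_comp _
  | swap v w =>
    rw [hom_delW_append, hom_delW_append, hom_par, hom_swap, ← BraidedCategory.braiding_naturality]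
    have : (β_ (𝟙_ (List Col)) (𝟙_ (List Col))).hom = 𝟙 _ := hom_eq_iff.2 (.swap_nil [])
    erw [this, Category.comp_id]
    rfl
  | seq c d ihc ihd => rw [hom_seq, Category.assoc, ihd, ihc]
  | par c d ihc ihd =>
    rw [hom_delW_append, hom_delW_append, hom_par, hom_par]
    erw [tensorHom_comp_tensorHom, ihc, ihd]
    rfl

instance (v : List Col) : Subsingleton (v ⟶ 𝟙_ (List Col)) where
  allEq f g := by
    obtain ⟨c, rfl⟩ := exists_hom f
    obtain ⟨d, rfl⟩ := exists_hom g
    have h (c : Circ v []) : hom c = hom (delW v) := (Category.comp_id _).symm.trans (hom_seq_delW c)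
    exact (h c).trans (h d).symm

end CGM

/-! ### Tuples in a symmetric monoidal category with terminal unit -/

namespace CGM

open CategoryTheory MonoidalCategory
open scoped ComonObj

section Pairing

set_option linter.unusedSectionVars false

universe v u

variable {C : Type u} [Category.{v} C] [MonoidalCategory C] [SymmetricCategory C]
variable {Γ X Y Z W : C} [ComonObj Γ]

/-- The morphism that copies its input and applies `f` and `g` to the two copies. -/
def pair (f : Γ ⟶ X) (g : Γ ⟶ Y) : Γ ⟶ X ⊗ Y := Δ[Γ] ≫ (f ⊗ₘ g)

theorem pair_tensorHom (f : Γ ⟶ X) (g : Γ ⟶ Y) (h : X ⟶ Z) (k : Y ⟶ W) :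
    pair f g ≫ (h ⊗ₘ k) = pair (f ≫ h) (g ≫ k) := by
  simp [pair]

theorem pair_whiskerRight (f : Γ ⟶ X) (g : Γ ⟶ Y) (h : X ⟶ Z) :
    pair f g ≫ h ▷ Y = pair (f ≫ h) g := by
  rw [← tensorHom_id, pair_tensorHom, Category.comp_id]

theorem pair_whiskerLeft (f : Γ ⟶ X) (g : Γ ⟶ Y) (h : Y ⟶ Z) :
    pair f g ≫ X ◁ h = pair f (g ≫ h) := by
  rw [← id_tensorHom, pair_tensorHom, Category.comp_id]

theorem pair_associator_hom (f : Γ ⟶ X) (g : Γ ⟶ Y) (h : Γ ⟶ Z) :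
    pair (pair f g) h ≫ (α_ X Y Z).hom = pair f (pair g h) := by
  have h1 : pair (pair f g) h = Δ[Γ] ≫ Δ[Γ] ▷ Γ ≫ ((f ⊗ₘ g) ⊗ₘ h) := by
    simp only [pair, ← tensorHom_id, tensorHom_comp_tensorHom, Category.id_comp]
  have h2 : pair f (pair g h) = Δ[Γ] ≫ Γ ◁ Δ[Γ] ≫ (f ⊗ₘ (g ⊗ₘ h)) := by
    simp only [pair, ← id_tensorHom, tensorHom_comp_tensorHom, Category.id_comp]
  rw [h1, h2, Category.assoc, Category.assoc, associator_naturality, ComonObj.comul_assoc_assoc]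

theorem pair_associator_inv (f : Γ ⟶ X) (g : Γ ⟶ Y) (h : Γ ⟶ Z) :
    pair f (pair g h) ≫ (α_ X Y Z).inv = pair (pair f g) h := by
  rw [← pair_associator_hom, Category.assoc, Iso.hom_inv_id, Category.comp_id]

theorem pair_braiding [IsCommComonObj Γ] (f : Γ ⟶ X) (g : Γ ⟶ Y) :
    pair f g ≫ (β_ X Y).hom = pair g f := by
  rw [pair, Category.assoc, BraidedCategory.braiding_naturality, ← Category.assoc,
    IsCommComonObj.comul_comm, pair]

/-- A morphism that commutes with copying. -/
def Det [ComonObj X] (f : Γ ⟶ X) : Prop := f ≫ Δ[X] = pair f f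

theorem Det.comp_pair [ComonObj X] {f : Γ ⟶ X} (hf : Det f) (g : X ⟶ Y) (h : X ⟶ Z) :
    f ≫ pair g h = pair (f ≫ g) (f ≫ h) := by
  rw [pair, ← Category.assoc, hf, pair_tensorHom]

theorem det_id : Det (𝟙 Γ) := by
  simp [Det, pair]

theorem Det.comp [ComonObj X] [ComonObj Y] {f : Γ ⟶ X} {g : X ⟶ Y} (hf : Det f) (hg : Det g) :
    Det (f ≫ g) := by
  rw [Det, Category.assoc, hg, hf.comp_pair]

/-- Tuples of deterministic morphisms are deterministic. Commutativity of the comonoid `Γ` is what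
allows the two middle copies to be exchanged. -/
theorem Det.pair [IsCommComonObj Γ] [ComonObj X] [ComonObj Y] {f : Γ ⟶ X} {g : Γ ⟶ Y}
    (hf : Det f) (hg : Det g) : Det (pair f g) := by
  rw [Det, Comon.tensorObj_comul, ← Category.assoc, pair_tensorHom, hf, hg, tensorμ]
  simp only [← Category.assoc, pair_associator_hom, pair_whiskerLeft, pair_associator_inv,
    pair_whiskerRight, pair_braiding]

section Terminal

/-! As the unit is terminal, the counit of a comonoid is natural, and the discarded component of a pair
disappears. -/

variable [∀ X : C, Subsingleton (X ⟶ 𝟙_ C)]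

variable (X Y) in
/-- The first projection, which discards the second factor. -/
def proj₁ [ComonObj Y] : X ⊗ Y ⟶ X := X ◁ ε[Y] ≫ (ρ_ X).hom

variable (X Y) in
/-- The second projection, which discards the first factor. -/
def proj₂ [ComonObj X] : X ⊗ Y ⟶ Y := ε[X] ▷ Y ≫ (λ_ Y).hom

theorem pair_proj₁ [ComonObj Y] (f : Γ ⟶ X) (g : Γ ⟶ Y) : pair f g ≫ proj₁ X Y = f := by
  rw [proj₁, ← Category.assoc, pair_whiskerLeft, Subsingleton.elim (g ≫ ε[Y]) ε[Γ], pair]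
  simp

theorem pair_proj₂ [ComonObj X] (f : Γ ⟶ X) (g : Γ ⟶ Y) : pair f g ≫ proj₂ X Y = g := by
  rw [proj₂, ← Category.assoc, pair_whiskerRight, Subsingleton.elim (f ≫ ε[X]) ε[Γ], pair]
  simp

theorem tensorHom_proj₁ [ComonObj Y] [ComonObj W] (f : X ⟶ Z) (g : Y ⟶ W) :
    (f ⊗ₘ g) ≫ proj₁ Z W = proj₁ X Y ≫ f := by
  rw [proj₁, proj₁, ← Category.assoc, ← id_tensorHom, ← id_tensorHom, tensorHom_comp_tensorHom,
    Category.comp_id, Subsingleton.elim (g ≫ ε[W]) ε[Y], Category.assoc,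
    ← rightUnitor_naturality, ← Category.assoc, ← tensorHom_id, tensorHom_comp_tensorHom]
  simp

theorem tensorHom_proj₂ [ComonObj X] [ComonObj Z] (f : X ⟶ Z) (g : Y ⟶ W) :
    (f ⊗ₘ g) ≫ proj₂ Z W = proj₂ X Y ≫ g := by
  rw [proj₂, proj₂, ← Category.assoc, ← tensorHom_id, ← tensorHom_id, tensorHom_comp_tensorHom,
    Category.comp_id, Subsingleton.elim (f ≫ ε[Z]) ε[X], Category.assoc,
    ← leftUnitor_naturality, ← Category.assoc, ← id_tensorHom, tensorHom_comp_tensorHom]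
  simp

theorem pair_proj [ComonObj X] [ComonObj Y] : pair (proj₁ X Y) (proj₂ X Y) = 𝟙 (X ⊗ Y) := by
  have h : tensorμ X X Y Y ≫ (proj₁ X Y ⊗ₘ proj₂ X Y) =
      (proj₁ X X ⊗ₘ proj₂ Y Y) := by
    have : (proj₁ X Y ⊗ₘ proj₂ X Y) = ((X ◁ ε[Y]) ⊗ₘ (ε[X] ▷ Y)) ≫ ((ρ_ X).hom ⊗ₘ (λ_ Y).hom) := by
      simp [proj₁, proj₂]
    rw [this, ← Category.assoc, ← id_tensorHom, ← tensorHom_id, ← tensorμ_natural, Category.assoc,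
      proj₁, proj₂, ← tensorHom_comp_tensorHom, id_tensorHom, tensorHom_id]
    congr 1
    rw [tensorμ, braiding_tensorUnit_left]
    monoidal
  rw [pair, Comon.tensorObj_comul, Category.assoc, h, tensorHom_comp_tensorHom]
  have h1 : Δ[X] ≫ proj₁ X X = 𝟙 X := by simp [proj₁]
  have h2 : Δ[Y] ≫ proj₂ Y Y = 𝟙 Y := by simp [proj₂]
  rw [h1, h2, id_tensorHom_id]

/-- A deterministic morphism into a product is determined by its components. -/
theorem Det.eq_pair [ComonObj X] [ComonObj Y] {f : Γ ⟶ X ⊗ Y} (hf : Det f) :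
    f = CGM.pair (f ≫ proj₁ X Y) (f ≫ proj₂ X Y) := by
  rw [← hf.comp_pair, pair_proj, Category.comp_id]

theorem det_proj₁ [ComonObj X] [ComonObj Y] : Det (proj₁ X Y) := by
  have h : tensorμ X X Y Y ≫ (proj₁ X Y ⊗ₘ proj₁ X Y) = proj₁ (X ⊗ X) (Y ⊗ Y) := by
    rw [proj₁, proj₁, ← tensorHom_comp_tensorHom, ← Category.assoc, ← tensorμ_natural_right,
      Category.assoc, tensor_right_unitality, Comon.tensorObj_counit, whiskerLeft_comp,
      Category.assoc, ← whiskerLeft_comp_assoc _ (λ_ _).hom, Iso.hom_inv_id]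
    simp
  rw [Det, pair, Comon.tensorObj_comul, Category.assoc, h, tensorHom_proj₁]

theorem det_proj₂ [ComonObj X] [ComonObj Y] : Det (proj₂ X Y) := by
  have h : tensorμ X X Y Y ≫ (proj₂ X Y ⊗ₘ proj₂ X Y) = proj₂ (X ⊗ X) (Y ⊗ Y) := by
    rw [proj₂, proj₂, ← tensorHom_comp_tensorHom, ← Category.assoc, ← tensorμ_natural_left,
      Category.assoc, tensor_left_unitality, Comon.tensorObj_counit, comp_whiskerRight,
      Category.assoc, ← comp_whiskerRight_assoc (λ_ _).hom, Iso.hom_inv_id]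
    simp
  rw [Det, pair, Comon.tensorObj_comul, Category.assoc, h, tensorHom_proj₂]

end Terminal

end Pairing

end CGM

/-! ### Comonoids on words and the if-then-else gates -/

namespace CGM

open Col Circ CategoryTheory MonoidalCategory
open scoped CGM.Circ ComonObj

instance comonObjSingleton (a : Col) : ComonObj [a] where
  counit := hom (del a)
  comul := hom (copy a)
  counit_comul := eqv_ax (.copy_del_left a)
  comul_counit := eqv_ax (.copy_del_right a)
  comul_assoc := by
    have h : (α_ [a] [a] [a]).hom = 𝟙 _ := rfl
    erw [h, Category.comp_id]
    exact (eqv_ax (.copy_assoc a)).symm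

instance (a : Col) : IsCommComonObj [a] where
  comul_comm := eqv_ax (.copy_comm a)

/-- The comonoid `R^n`, the tensor product of `n` copies of `R`. -/
instance comonObjRw : (n : ℕ) → ComonObj (Rw n)
  | 0 => ComonObj.instTensorUnit (List Col)
  | n + 1 =>
    letI := comonObjRw n
    inferInstanceAs (ComonObj ([R] ⊗ Rw n))

instance isCommComonObjRw : (n : ℕ) → IsCommComonObj (Rw n)
  | 0 => CommComon.instCommComonObjUnit
  | n + 1 =>
    letI := isCommComonObjRw n
    inferInstanceAs (IsCommComonObj ([R] ⊗ Rw n))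

theorem hom_copyW_cons (a : Col) (v : List Col) :
    hom (copyW (a :: v)) = (hom (copy a) ⊗ₘ hom (copyW v)) ≫ tensorμ [a] [a] v v := by
  have h2 : hom (copyW (a :: v)) = (hom (copy a) ⊗ₘ hom (copyW v)) ≫
      (eqToHom rfl : _ ⟶ ([a] ⊗ (([a] ⊗ v) ⊗ v) : List Col)) ≫
        ([a] ◁ ((β_ [a] v).hom ▷ v)) ≫
        eqToHom (congrArg ([a] ++ ·) (List.append_assoc v [a] v)) := by
    rw [copyW, hom_seq, hom_cast]
    rfl
  rw [h2, tensorμ]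
  simp only [associator_hom_eq, associator_inv_eq, whiskerLeft_eqToHom, eqToHom_trans,
    eqToHom_trans_assoc]

theorem comul_Rw (n : ℕ) : Δ[Rw n] = hom (copyW (Rw n)) := by
  induction n with
  | zero => rfl
  | succ n ih =>
    have h1 : Δ[Rw (n + 1)] = (Δ[[R]] ⊗ₘ Δ[Rw n]) ≫ tensorμ [R] [R] (Rw n) (Rw n) :=
      Comon.tensorObj_comul _ _
    exact h1.trans ((congrArg (fun f => (hom (copy R) ⊗ₘ f) ≫ _) ih).trans
      (hom_copyW_cons R (Rw n)).symm)

variable {Γ : List Col} [ComonObj Γ]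

/-- The associator of `[a]`, `v`, `w` is an identity, since `([a] ++ v) ++ w` and `[a] ++ (v ++ w)` are
equal by definition. -/
theorem pair_assoc_singleton {a : Col} {v w : List Col} (f : Γ ⟶ [a]) (g : Γ ⟶ v) (h : Γ ⟶ w) :
    pair (X := [a] ⊗ v) (pair f g) h = pair (Y := v ⊗ w) f (pair g h) :=
  (Category.comp_id _).symm.trans (pair_associator_hom f g h)

/-- The gate `ifte` as a morphism from a tensor product. -/
def iteGate : ([B] ⊗ ([R] ⊗ [R]) : List Col) ⟶ [R] := hom ifte

/-- The circuit `ifteW n` as a morphism from a tensor product. -/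
def iteGateW (n : ℕ) : ([B] ⊗ (Rw n ⊗ Rw n) : List Col) ⟶ Rw n := hom (ifteW n)

/-- The recursion for `ifteW`, with the transport in its definition read as an associator. -/
theorem iteGateW_add_two (n : ℕ) :
    iteGateW (n + 2) =
      ((Δ[[B]] ▷ (([R] ⊗ Rw (n + 1)) ⊗ ([R] ⊗ Rw (n + 1))) :
        _ ⟶ ([B] ⊗ (([B] ⊗ [R]) ⊗ (Rw (n + 1) ⊗ ([R] ⊗ Rw (n + 1)))) : List Col)) ≫
      ([B] ◁ ((β_ [B] [R]).hom ▷ (Rw (n + 1) ⊗ ([R] ⊗ Rw (n + 1)))) :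
        _ ⟶ (([B] ⊗ [R]) ⊗ (([B] ⊗ Rw (n + 1)) ⊗ ([R] ⊗ Rw (n + 1))) : List Col)) ≫
      (([B] ⊗ [R]) ◁ ((α_ ([B] ⊗ Rw (n + 1)) [R] (Rw (n + 1))).inv ≫
        ((β_ ([B] ⊗ Rw (n + 1)) [R]).hom ▷ Rw (n + 1))) :
        _ ⟶ (([B] ⊗ ([R] ⊗ [R])) ⊗ ([B] ⊗ (Rw (n + 1) ⊗ Rw (n + 1))) : List Col)) ≫
      ((iteGate ⊗ₘ iteGateW (n + 1)) :
        _ ⟶ ([R] ⊗ Rw (n + 1) : List Col)) :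
        ([B] ⊗ (([R] ⊗ Rw (n + 1)) ⊗ ([R] ⊗ Rw (n + 1))) : List Col) ⟶ [R] ⊗ Rw (n + 1)) := by
  rw [iteGateW, ifteW, hom_seq, hom_seq, hom_seq, hom_cast, associator_inv_eq, whiskerLeft_comp,
    whiskerLeft_eqToHom]
  simp only [Category.assoc]
  change hom (copy B ⊠ idw (Rw (n + 2) ++ Rw (n + 2))) ≫
    hom (idw [B] ⊠ swap [B] [R] ⊠ idw (Rw (n + 1) ++ Rw (n + 2))) ≫ _ ≫ _ ≫ 𝟙 _ ≫ _ = _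
  rw [Category.id_comp]
  rfl

end CGM

/-! ### If-then-else of morphisms with a common domain -/

namespace CGM

open Col Circ CategoryTheory MonoidalCategory
open scoped CGM.Circ ComonObj

set_option linter.unusedSectionVars false

variable {Γ : List Col} [ComonObj Γ]

/-- If-then-else of morphisms with a common domain. -/
def ite' (b : Γ ⟶ [B]) (x y : Γ ⟶ [R]) : Γ ⟶ [R] := pair b (pair x y) ≫ iteGate

/-- If-then-else of morphisms into `R^n` with a common domain. -/
def iteW (n : ℕ) (b : Γ ⟶ [B]) (x y : Γ ⟶ Rw n) : Γ ⟶ Rw n := pair b (pair x y) ≫ iteGateW n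

/-- Adding a wire in front of `n` wires. -/
def consR {n : ℕ} (x : Γ ⟶ [R]) (y : Γ ⟶ Rw n) : Γ ⟶ Rw (n + 1) := pair x y

/-! The next lemmas evaluate a composite stage by stage. The stages are checked separately because the
objects between them are words that agree only up to unfolding `++`. -/

theorem comp_four_eq {C : Type*} [Category C] {a b c d e f : C} {p : a ⟶ b} {p₁ : a ⟶ c}
    {p₂ : a ⟶ d} {p₃ : a ⟶ e} {p₄ : a ⟶ f} {s₁ : b ⟶ c} {s₂ : c ⟶ d} {s₃ : d ⟶ e} {s₄ : e ⟶ f}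
    (h₁ : p ≫ s₁ = p₁) (h₂ : p₁ ≫ s₂ = p₂) (h₃ : p₂ ≫ s₃ = p₃) (h₄ : p₃ ≫ s₄ = p₄) :
    p ≫ s₁ ≫ s₂ ≫ s₃ ≫ s₄ = p₄ := by
  rw [← h₄, ← h₃, ← h₂, ← h₁]
  simp

theorem comp_two_eq {C : Type*} [Category C] {a b c d : C} {p : a ⟶ b} {p₁ : a ⟶ c}
    {p₂ : a ⟶ d} {s₁ : b ⟶ c} {s₂ : c ⟶ d}
    (h₁ : p ≫ s₁ = p₁) (h₂ : p₁ ≫ s₂ = p₂) : p ≫ s₁ ≫ s₂ = p₂ := by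
  rw [← h₂, ← h₁]
  simp

theorem comp_three_eq {C : Type*} [Category C] {a b c d e : C} {p : a ⟶ b} {p₁ : a ⟶ c}
    {p₂ : a ⟶ d} {p₃ : a ⟶ e} {s₁ : b ⟶ c} {s₂ : c ⟶ d} {s₃ : d ⟶ e}
    (h₁ : p ≫ s₁ = p₁) (h₂ : p₁ ≫ s₂ = p₂) (h₃ : p₂ ≫ s₃ = p₃) :
    p ≫ (s₁ ≫ s₂) ≫ s₃ = p₃ := by
  rw [← h₃, ← h₂, ← h₁]
  simp

theorem comp_four_eq' {C : Type*} [Category C] {a b c d e f : C} {p : a ⟶ b} {p₁ : a ⟶ c}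
    {p₂ : a ⟶ d} {p₃ : a ⟶ e} {p₄ : a ⟶ f} {s₁ : b ⟶ c} {s₂ : c ⟶ d} {s₃ : d ⟶ e} {s₄ : e ⟶ f}
    (h₁ : p ≫ s₁ = p₁) (h₂ : p₁ ≫ s₂ = p₂) (h₃ : p₂ ≫ s₃ = p₃) (h₄ : p₃ ≫ s₄ = p₄) :
    p ≫ ((s₁ ≫ s₂) ≫ s₃) ≫ s₄ = p₄ := by
  rw [← h₄, ← h₃, ← h₂, ← h₁]
  simp

/-- `ifteW (n + 2)` uses its guard twice, so that the guard has to be deterministic. -/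
theorem iteW_add_two [IsCommComonObj Γ] {n : ℕ} {b : Γ ⟶ [B]} (hb : Det b) (x y : Γ ⟶ [R])
    (x' y' : Γ ⟶ Rw (n + 1)) :
    iteW (n + 2) b (consR x x') (consR y y') = consR (ite' b x y) (iteW (n + 1) b x' y') := by
  have hb' : b ≫ Δ[[B]] = pair b b := hb
  have h1 : pair b (pair (consR x x') (consR y y')) ≫ Δ[[B]] ▷ _ =
      pair (Y := ([B] ⊗ [R]) ⊗ (Rw (n + 1) ⊗ ([R] ⊗ Rw (n + 1)))) b
        (pair (pair b x) (pair x' (pair y y'))) := by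
    rw [pair_whiskerRight, hb']
    exact (pair_assoc_singleton b b _).trans (congrArg (pair b)
      ((congrArg (pair b) (pair_assoc_singleton x x' _)).trans (pair_assoc_singleton b x _).symm))
  have h2 : pair (Y := ([B] ⊗ [R]) ⊗ (Rw (n + 1) ⊗ ([R] ⊗ Rw (n + 1)))) b
        (pair (pair b x) (pair x' (pair y y'))) ≫
        ([B] ◁ ((β_ [B] [R]).hom ▷ (Rw (n + 1) ⊗ ([R] ⊗ Rw (n + 1))))) =
      pair (Y := ([B] ⊗ Rw (n + 1)) ⊗ ([R] ⊗ Rw (n + 1))) (pair b x)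
        (pair (pair b x') (pair y y')) := by
    rw [pair_whiskerLeft, pair_whiskerRight, pair_braiding]
    exact (congrArg (pair b) (pair_assoc_singleton x b _)).trans
      ((pair_assoc_singleton b x _).symm.trans
        (congrArg (pair (pair b x)) (pair_assoc_singleton b x' _).symm))
  have h3 : pair (pair b x) (pair (pair b x') (pair y y')) ≫
        ([B] ⊗ [R]) ◁ ((α_ ([B] ⊗ Rw (n + 1)) [R] (Rw (n + 1))).inv ≫
          ((β_ ([B] ⊗ Rw (n + 1)) [R]).hom ▷ Rw (n + 1))) =
      pair (X := [B] ⊗ ([R] ⊗ [R])) (Y := [B] ⊗ (Rw (n + 1) ⊗ Rw (n + 1))) (pair b (pair x y))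
        (pair b (pair x' y')) := by
    rw [pair_whiskerLeft, ← Category.assoc, pair_associator_inv, pair_whiskerRight, pair_braiding]
    refine (congrArg (pair (pair b x)) ((pair_assoc_singleton y (pair b x') y').trans
      (congrArg (pair y) (pair_assoc_singleton b x' y')))).trans ?_
    refine (pair_assoc_singleton b x _).trans ?_
    refine (congrArg (pair b) (pair_assoc_singleton x y _).symm).trans ?_
    exact (pair_assoc_singleton b (pair x y) _).symm
  exact (congrArg (pair b (pair (consR x x') (consR y y')) ≫ ·) (iteGateW_add_two n)).trans
    (comp_four_eq h1 h2 h3 (pair_tensorHom _ _ iteGate (iteGateW (n + 1))))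

theorem pair_unit_left {v : List Col} (f : Γ ⟶ 𝟙_ (List Col)) (g : Γ ⟶ v) :
    pair (X := 𝟙_ (List Col)) (Y := v) f g = g := by
  rw [Subsingleton.elim f ε[Γ], pair, ComonObj.counit_comul_hom]
  exact Category.comp_id g

theorem pair_unit_right {a : Col} (f : Γ ⟶ [a]) (g : Γ ⟶ 𝟙_ (List Col)) :
    pair (X := [a]) (Y := 𝟙_ (List Col)) f g = f := by
  rw [Subsingleton.elim g ε[Γ], pair, ComonObj.comul_counit_hom]
  exact Category.comp_id f

theorem iteGateW_natural {m n : ℕ} (c : Circ (Rw m) (Rw n)) :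
    [B] ◁ (hom c ⊗ₘ hom c) ≫ iteGateW n = iteGateW m ≫ hom c :=
  eqv_ax (.ifte_natural c)

theorem iteW_comp {m n : ℕ} (c : Circ (Rw m) (Rw n)) (b : Γ ⟶ [B]) (x y : Γ ⟶ Rw m) :
    iteW m b x y ≫ hom c = iteW n b (x ≫ hom c) (y ≫ hom c) := by
  rw [iteW, Category.assoc, ← iteGateW_natural, ← Category.assoc, pair_whiskerLeft,
    pair_tensorHom, iteW]

variable [IsCommComonObj Γ]

/-- If-then-else commutes with copying: this is `ifte_natural` for the circuit `copy R`. -/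
theorem Det.ite' {b : Γ ⟶ [B]} {x y : Γ ⟶ [R]} (hb : Det b) (hx : Det x) (hy : Det y) :
    Det (ite' b x y) := by
  have hx' : x ≫ hom (copy R) = CGM.pair x x := hx
  have hy' : y ≫ hom (copy R) = CGM.pair y y := hy
  have h := iteW_comp (m := 1) (n := 2) (copy R) b x y
  exact h.trans ((congrArg₂ (iteW 2 b) hx' hy').trans (iteW_add_two (n := 0) hb x y x y))

theorem iteW_succ {n : ℕ} {b : Γ ⟶ [B]} (hb : Det b) (x y : Γ ⟶ [R]) (x' y' : Γ ⟶ Rw n) :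
    iteW (n + 1) b (consR x x') (consR y y') = consR (ite' b x y) (iteW n b x' y') := by
  cases n with
  | zero =>
    exact (congrArg₂ (iteW 1 b) (pair_unit_right x x') (pair_unit_right y y')).trans
      (pair_unit_right _ _).symm
  | succ n => exact iteW_add_two hb x y x' y'

theorem Det.exists_consR {n : ℕ} {x : Γ ⟶ Rw (n + 1)} (hx : Det x) :
    ∃ (x₀ : Γ ⟶ [R]) (x' : Γ ⟶ Rw n), Det x₀ ∧ Det x' ∧ x = consR x₀ x' := by
  have hx' : Det (X := [R] ⊗ Rw n) x := hx
  exact ⟨_, _, hx'.comp det_proj₁, hx'.comp det_proj₂,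
    Det.eq_pair (X := [R]) (Y := Rw n) hx'⟩

theorem det_to_Rw_zero (x : Γ ⟶ Rw 0) : Det x := by
  have h1 : x = ε[Γ] := Subsingleton.elim (α := Γ ⟶ 𝟙_ (List Col)) _ _
  subst h1
  refine Eq.trans ?_ (pair_unit_left (v := 𝟙_ (List Col)) _ _).symm
  exact Category.comp_id _

/-! ### The equations for a single gate -/

theorem ite_guard_left {b : Γ ⟶ [B]} (hb : Det b) (x y z : Γ ⟶ [R]) :
    ite' b (ite' b x y) z = ite' b x z := by
  have hb' : b ≫ Δ[[B]] = pair b b := hb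
  have h : (Δ[[B]] ▷ ([R] ⊗ ([R] ⊗ [R])) ≫ ([B] ◁ (iteGate ▷ [R]) :
      ([B] ⊗ (([B] ⊗ ([R] ⊗ [R])) ⊗ [R]) : List Col) ⟶ [B] ⊗ ([R] ⊗ [R]))) ≫ iteGate =
      (([B] ⊗ [R]) ◁ (ε[[R]] ▷ [R]) : (([B] ⊗ [R]) ⊗ ([R] ⊗ [R]) : List Col) ⟶ _) ≫ iteGate :=
    eqv_ax .ifte_guard_left
  have h1 : pair b (pair x (pair y z)) ≫ Δ[[B]] ▷ ([R] ⊗ ([R] ⊗ [R])) =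
      pair (Y := ([B] ⊗ ([R] ⊗ [R])) ⊗ [R]) b (pair (pair b (pair x y)) z) := by
    rw [pair_whiskerRight, hb']
    refine (pair_assoc_singleton b b _).trans (congrArg (pair b) ?_)
    exact (congrArg (pair b) (pair_assoc_singleton x y z).symm).trans
      (pair_assoc_singleton b (pair x y) z).symm
  have h2 : pair (Y := ([B] ⊗ ([R] ⊗ [R])) ⊗ [R]) b (pair (pair b (pair x y)) z) ≫
      [B] ◁ (iteGate ▷ [R]) = pair b (pair (ite' b x y) z) := by
    rw [pair_whiskerLeft, pair_whiskerRight, ite']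
  have h3 : pair (pair b x) (pair y z) ≫ ([B] ⊗ [R]) ◁ (ε[[R]] ▷ [R]) =
      pair (Y := [R] ⊗ [R]) b (pair x z) := by
    rw [pair_whiskerLeft, pair_whiskerRight]
    exact (congrArg (pair (pair b x)) (pair_unit_left _ z)).trans (pair_assoc_singleton b x z)
  have h4 : pair (pair b x) (pair y z) = pair (Y := [R] ⊗ ([R] ⊗ [R])) b (pair x (pair y z)) :=
    pair_assoc_singleton b x _
  exact (comp_three_eq h1 h2 rfl).symm.trans ((congrArg (pair b (pair x (pair y z)) ≫ ·) h).trans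
    (comp_two_eq (h4 ▸ h3) rfl))

theorem ite_guard_right {b : Γ ⟶ [B]} (hb : Det b) (x y z : Γ ⟶ [R]) :
    ite' b x (ite' b y z) = ite' b x z := by
  have hb' : b ≫ Δ[[B]] = pair b b := hb
  have h : (([B] ⊗ [R]) ◁ (ε[[R]] ▷ [R]) : (([B] ⊗ [R]) ⊗ ([R] ⊗ [R]) : List Col) ⟶ _) ≫ iteGate =
      ((Δ[[B]] ▷ ([R] ⊗ ([R] ⊗ [R])) ≫ ([B] ◁ ((β_ [B] [R]).hom ▷ ([R] ⊗ [R])) :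
      ([B] ⊗ (([B] ⊗ [R]) ⊗ ([R] ⊗ [R])) : List Col) ⟶ ([B] ⊗ [R]) ⊗ ([B] ⊗ ([R] ⊗ [R])))) ≫
      (([B] ⊗ [R]) ◁ iteGate)) ≫ iteGate :=
    eqv_ax .ifte_guard_right
  have h1 : pair b (pair x (pair y z)) ≫ Δ[[B]] ▷ ([R] ⊗ ([R] ⊗ [R])) =
      pair (Y := ([B] ⊗ [R]) ⊗ ([R] ⊗ [R])) b (pair (pair b x) (pair y z)) := by
    rw [pair_whiskerRight, hb']
    exact (pair_assoc_singleton b b _).trans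
      (congrArg (pair b) (pair_assoc_singleton b x _).symm)
  have h2 : pair (Y := ([B] ⊗ [R]) ⊗ ([R] ⊗ [R])) b (pair (pair b x) (pair y z)) ≫
      [B] ◁ ((β_ [B] [R]).hom ▷ ([R] ⊗ [R])) =
      pair (Y := [B] ⊗ ([R] ⊗ [R])) (pair b x) (pair b (pair y z)) := by
    rw [pair_whiskerLeft, pair_whiskerRight, pair_braiding]
    exact (congrArg (pair b) (pair_assoc_singleton x b _)).trans (pair_assoc_singleton b x _).symm
  have h2' : pair (Y := [B] ⊗ ([R] ⊗ [R])) (pair b x) (pair b (pair y z)) ≫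
      ([B] ⊗ [R]) ◁ iteGate = pair (Y := [R] ⊗ [R]) b (pair x (ite' b y z)) := by
    rw [pair_whiskerLeft, ite']
    exact pair_assoc_singleton b x _
  have h3 : pair (pair b x) (pair y z) ≫ ([B] ⊗ [R]) ◁ (ε[[R]] ▷ [R]) =
      pair (Y := [R] ⊗ [R]) b (pair x z) := by
    rw [pair_whiskerLeft, pair_whiskerRight]
    exact (congrArg (pair (pair b x)) (pair_unit_left _ z)).trans (pair_assoc_singleton b x z)
  have h4 : pair (pair b x) (pair y z) = pair (Y := [R] ⊗ ([R] ⊗ [R])) b (pair x (pair y z)) :=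
    pair_assoc_singleton b x _
  exact (comp_four_eq' h1 h2 h2' rfl).symm.trans
    ((congrArg (pair b (pair x (pair y z)) ≫ ·) h.symm).trans (comp_two_eq (h4 ▸ h3) rfl))

theorem ite_ite {a b : Γ ⟶ [B]} (ha : Det a) (hb : Det b) (x y z t : Γ ⟶ [R]) :
    ite' a (ite' b x y) (ite' b z t) = ite' b (ite' a x z) (ite' a y t) := by
  have key {a b : Γ ⟶ [B]} (hb : Det b) (x y z t : Γ ⟶ [R]) :
      pair a (pair b (pair x (pair y (pair z t)))) ≫
        (hom nested : ([B] ⊗ ([B] ⊗ ([R] ⊗ ([R] ⊗ ([R] ⊗ [R])))) : List Col) ⟶ [R]) =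
      ite' a (ite' b x y) (ite' b z t) := by
    have hb' : b ≫ Δ[[B]] = pair b b := hb
    have h1 : pair a (pair b (pair x (pair y (pair z t)))) ≫
        [B] ◁ (Δ[[B]] ▷ ([R] ⊗ ([R] ⊗ ([R] ⊗ [R])))) =
        pair (X := [B] ⊗ [B]) (Y := ([B] ⊗ ([R] ⊗ [R])) ⊗ ([R] ⊗ [R])) (pair a b)
          (pair (pair b (pair x y)) (pair z t)) := by
      rw [pair_whiskerLeft, pair_whiskerRight, hb']
      refine Eq.trans ?_ (pair_assoc_singleton a b _).symm
      refine congrArg (pair a) ((pair_assoc_singleton b b _).trans (congrArg (pair b) ?_))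
      exact Eq.trans (congrArg (pair b) (pair_assoc_singleton x y _).symm)
        (pair_assoc_singleton b (pair x y) _).symm
    have h2 : pair (X := [B] ⊗ [B]) (Y := ([B] ⊗ ([R] ⊗ [R])) ⊗ ([R] ⊗ [R])) (pair a b)
          (pair (pair b (pair x y)) (pair z t)) ≫
          ([B] ⊗ [B]) ◁ ((β_ [B] ([R] ⊗ [R])).hom ▷ ([R] ⊗ [R])) =
        pair (Y := ([B] ⊗ ([R] ⊗ [R])) ⊗ ([B] ⊗ ([R] ⊗ [R]))) a
          (pair (pair b (pair x y)) (pair b (pair z t))) := by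
      rw [pair_whiskerLeft, pair_whiskerRight, pair_braiding]
      refine (pair_assoc_singleton a b _).trans (congrArg (pair a) ?_)
      refine Eq.trans (congrArg (pair b) ?_) (pair_assoc_singleton b (pair x y) _).symm
      refine (congrArg (pair · _) (pair_assoc_singleton x y b)).trans ?_
      refine (pair_assoc_singleton x (pair y b) _).trans ?_
      refine (congrArg (pair x) (pair_assoc_singleton y b _)).trans ?_
      exact (pair_assoc_singleton x y _).symm
    have h3 : pair (Y := ([B] ⊗ ([R] ⊗ [R])) ⊗ ([B] ⊗ ([R] ⊗ [R]))) a
          (pair (pair b (pair x y)) (pair b (pair z t))) ≫ [B] ◁ (iteGate ⊗ₘ iteGate) =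
        pair a (pair (ite' b x y) (ite' b z t)) := by
      rw [pair_whiskerLeft, pair_tensorHom, ite', ite']
    have hn : (hom nested : ([B] ⊗ ([B] ⊗ ([R] ⊗ ([R] ⊗ ([R] ⊗ [R])))) : List Col) ⟶ [R]) =
        (((([B] ◁ (Δ[[B]] ▷ ([R] ⊗ ([R] ⊗ ([R] ⊗ [R]))))) :
          _ ⟶ (([B] ⊗ [B]) ⊗ (([B] ⊗ ([R] ⊗ [R])) ⊗ ([R] ⊗ [R])) : List Col)) ≫
        (([B] ⊗ [B]) ◁ ((β_ [B] ([R] ⊗ [R])).hom ▷ ([R] ⊗ [R])) :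
          _ ⟶ ([B] ⊗ (([B] ⊗ ([R] ⊗ [R])) ⊗ ([B] ⊗ ([R] ⊗ [R]))) : List Col))) ≫
        [B] ◁ (iteGate ⊗ₘ iteGate)) ≫ iteGate := rfl
    rw [hn]
    exact comp_four_eq' h1 h2 h3 rfl
  have h : hom nested =
      (((β_ [B] [B]).hom ⊗ₘ ([R] ◁ ((β_ [R] [R]).hom ▷ [R]) :
        ([R] ⊗ (([R] ⊗ [R]) ⊗ [R]) : List Col) ⟶ _)) :
          (([B] ⊗ [B]) ⊗ ([R] ⊗ (([R] ⊗ [R]) ⊗ [R])) : List Col) ⟶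
          ([B] ⊗ [B]) ⊗ ([R] ⊗ (([R] ⊗ [R]) ⊗ [R]))) ≫ hom nested := eqv_ax .ifte_ifte
  have h1 : pair (pair a b) (pair x (pair (pair y z) t)) =
      pair (Y := [B] ⊗ ([R] ⊗ ([R] ⊗ ([R] ⊗ [R])))) a (pair b (pair x (pair y (pair z t)))) :=
    (pair_assoc_singleton a b _).trans (congrArg (fun f => pair a (pair b (pair x f)))
      (pair_assoc_singleton y z t))
  have h2 : pair (pair a b) (pair x (pair (pair y z) t)) ≫
      ((β_ [B] [B]).hom ⊗ₘ ([R] ◁ ((β_ [R] [R]).hom ▷ [R]))) =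
      pair (Y := [B] ⊗ ([R] ⊗ ([R] ⊗ ([R] ⊗ [R])))) b (pair a (pair x (pair z (pair y t)))) := by
    rw [pair_tensorHom, pair_whiskerLeft, pair_whiskerRight, pair_braiding, pair_braiding]
    exact (pair_assoc_singleton b a _).trans (congrArg (fun f => pair b (pair a (pair x f)))
      (pair_assoc_singleton z y t))
  rw [← key hb, ← key ha]
  exact (congrArg (· ≫ hom nested) h1.symm).trans ((congrArg (_ ≫ ·) h).trans
    (comp_two_eq h2 rfl))

theorem ite_and (a b : Γ ⟶ [B]) (x : Γ ⟶ [R]) {y : Γ ⟶ [R]} (hy : Det y) :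
    ite' (pair a b ≫ hom andg) x y = ite' a (ite' b x y) y := by
  have hy' : y ≫ Δ[[R]] = pair y y := hy
  have h : (hom andg : ([B] ⊗ [B] : List Col) ⟶ [B]) ▷ ([R] ⊗ [R]) ≫ iteGate =
      (((([B] ⊗ ([B] ⊗ [R])) ◁ Δ[[R]]) : (([B] ⊗ ([B] ⊗ [R])) ⊗ [R] : List Col) ⟶
        [B] ⊗ (([B] ⊗ ([R] ⊗ [R])) ⊗ [R])) ≫ [B] ◁ (iteGate ▷ [R])) ≫ iteGate :=
    eqv_ax .ifte_and
  have h0 : pair (pair a b) (pair x y) =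
      pair (X := [B] ⊗ ([B] ⊗ [R])) (Y := [R]) (pair a (pair b x)) y :=
    (pair_assoc_singleton a b _).trans (Eq.symm ((pair_assoc_singleton a (pair b x) y).trans
      (congrArg (pair a) (pair_assoc_singleton b x y))))
  have h1 : pair (X := [B] ⊗ ([B] ⊗ [R])) (Y := [R]) (pair a (pair b x)) y ≫
      (([B] ⊗ ([B] ⊗ [R])) ◁ Δ[[R]]) =
      pair (Y := ([B] ⊗ ([R] ⊗ [R])) ⊗ [R]) a (pair (pair b (pair x y)) y) := by
    rw [pair_whiskerLeft, hy']
    refine (pair_assoc_singleton a (pair b x) _).trans (congrArg (pair a) ?_)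
    refine (pair_assoc_singleton b x _).trans ?_
    refine (congrArg (pair b) (pair_assoc_singleton x y y).symm).trans ?_
    exact (pair_assoc_singleton b (pair x y) y).symm
  have h2 : pair (Y := ([B] ⊗ ([R] ⊗ [R])) ⊗ [R]) a (pair (pair b (pair x y)) y) ≫
      [B] ◁ (iteGate ▷ [R]) = pair a (pair (ite' b x y) y) := by
    rw [pair_whiskerLeft, pair_whiskerRight, ite']
  rw [ite', ← pair_whiskerRight, Category.assoc, h]
  exact (congrArg (· ≫ _) h0).trans (comp_three_eq h1 h2 rfl)

theorem ite_idem (b : Γ ⟶ [B]) {x : Γ ⟶ [R]} (hx : Det x) : ite' b x x = x := by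
  have hx' : x ≫ Δ[[R]] = pair x x := hx
  have h : [B] ◁ Δ[[R]] ≫ iteGate = ε[[B]] ▷ [R] := eqv_ax .ifte_idem
  rw [ite', ← hx', ← pair_whiskerLeft, Category.assoc, h, pair_whiskerRight]
  exact pair_unit_left _ _

theorem ite_not (b : Γ ⟶ [B]) (x y : Γ ⟶ [R]) : ite' (b ≫ hom notg) x y = ite' b y x := by
  have h : hom notg ▷ ([R] ⊗ [R]) ≫ iteGate = [B] ◁ (β_ [R] [R]).hom ≫ iteGate :=
    eqv_ax .ifte_not
  rw [ite', ← pair_whiskerRight, Category.assoc, h, ← Category.assoc, pair_whiskerLeft,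
    pair_braiding, ite']

end CGM

/-! ### Guards and the equations for several wires -/

namespace CGM

open Col Circ CategoryTheory MonoidalCategory
open scoped CGM.Circ ComonObj

set_option linter.unusedSectionVars false

section Gates

variable {Γ : List Col} [ComonObj Γ]

theorem hom_copyW_singleton (a : Col) : hom (copyW [a]) = hom (copy a) := by
  refine hom_eq_iff.2 (.trans (.seq_congr (.par_nil (copy a)) ?_) (.seq_id (copy a)))
  refine .trans (Eqv.cast_left _ _ _) (.trans (.par_congr (.refl (idw [a]))
    (.trans (.par_congr (.swap_nil [a]) (.refl (idw []))) (.par_nil _))) (.id_par_id [a] [a]))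

/-- Negation of a guard. -/
def notB (b : Γ ⟶ [B]) : Γ ⟶ [B] := b ≫ hom notg

/-- Conjunction of guards. -/
def andB (a b : Γ ⟶ [B]) : Γ ⟶ [B] := pair a b ≫ hom andg

theorem Det.notB {b : Γ ⟶ [B]} (hb : Det b) : Det (notB b) := by
  refine hb.comp ?_
  have h := eqv_ax (.gen_copy .notg trivial)
  rw [hom_seq, hom_seq, hom_copyW_singleton] at h
  exact h

theorem hom_copyW_BB : Δ[([B] ⊗ [B] : List Col)] = hom (copyW [B, B]) := by
  have h1 : hom (copyW [B, B]) = (hom (copy B) ⊗ₘ hom (copyW [B])) ≫ tensorμ [B] [B] [B] [B] :=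
    hom_copyW_cons B [B]
  rw [h1, hom_copyW_singleton]
  exact Comon.tensorObj_comul _ _

variable [IsCommComonObj Γ]

theorem Det.andB {a b : Γ ⟶ [B]} (ha : Det a) (hb : Det b) : Det (andB a b) := by
  refine (Det.pair ha hb).comp ?_
  have h := eqv_ax (.gen_copy .andg trivial)
  rw [hom_seq, hom_seq, hom_copyW_singleton] at h
  exact h.trans (congrArg (· ≫ _) hom_copyW_BB.symm)

/-- The guard that is always true. -/
def trueB : Γ ⟶ [B] := ε[Γ] ≫ hom (flip 1)

theorem det_trueB : Det (trueB (Γ := Γ)) := by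
  refine Det.comp (X := Rw 0) (det_to_Rw_zero ε[Γ]) ?_
  have h : hom (flip 1 ⨟ copy B) = hom (flip 1 ⊠ flip 1) :=
    eqv_ax (.bool (p := 0) (q := 2) _ _ ⟨trivial, trivial⟩ ⟨trivial, trivial⟩ flip_one_copy_sem)
  exact h.trans (Category.id_comp _).symm

theorem ite_true (x y : Γ ⟶ [R]) : ite' trueB x y = x := by
  have h : (hom (flip 1) : 𝟙_ (List Col) ⟶ [B]) ▷ ([R] ⊗ [R]) ≫ iteGate =
      ([R] ◁ ε[[R]] : ([R] ⊗ [R] : List Col) ⟶ [R] ⊗ 𝟙_ (List Col)) := eqv_ax .ifte_true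
  rw [ite', trueB, ← pair_whiskerRight, Category.assoc, h]
  have h1 : pair (X := 𝟙_ (List Col)) (Y := [R] ⊗ [R]) ε[Γ] (pair x y) = pair x y :=
    pair_unit_left _ _
  refine (congrArg (· ≫ _) h1).trans ((pair_whiskerLeft x y ε[[R]]).trans ?_)
  exact pair_unit_right _ _

theorem eq_of_Rw_zero {x y : Γ ⟶ Rw 0} : x = y :=
  Subsingleton.elim (α := Γ ⟶ 𝟙_ (List Col)) _ _

theorem iteW_idem {n : ℕ} {b : Γ ⟶ [B]} {x : Γ ⟶ Rw n} (hb : Det b) (hx : Det x) :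
    iteW n b x x = x := by
  induction n with
  | zero => exact eq_of_Rw_zero
  | succ n ih =>
    obtain ⟨x₀, x', hx₀, hx', rfl⟩ := hx.exists_consR
    rw [iteW_succ hb, ite_idem _ hx₀, ih hx']

theorem iteW_not {n : ℕ} {b : Γ ⟶ [B]} {x y : Γ ⟶ Rw n} (hb : Det b) (hx : Det x) (hy : Det y) :
    iteW n (notB b) x y = iteW n b y x := by
  induction n with
  | zero => exact eq_of_Rw_zero
  | succ n ih =>
    obtain ⟨x₀, x', hx₀, hx', rfl⟩ := hx.exists_consR
    obtain ⟨y₀, y', hy₀, hy', rfl⟩ := hy.exists_consR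
    rw [iteW_succ hb, iteW_succ hb.notB, ih hx' hy', notB, ite_not]

theorem iteW_true {n : ℕ} {x y : Γ ⟶ Rw n} (hx : Det x) (hy : Det y) :
    iteW n trueB x y = x := by
  induction n with
  | zero => exact eq_of_Rw_zero
  | succ n ih =>
    obtain ⟨x₀, x', hx₀, hx', rfl⟩ := hx.exists_consR
    obtain ⟨y₀, y', hy₀, hy', rfl⟩ := hy.exists_consR
    rw [iteW_succ det_trueB, ih hx' hy', ite_true]

/-- If-then-else associates to the right when the guard `a` of the inner branch is replaced by
`b ∧ a`. -/
theorem ite_and_ite {a b : Γ ⟶ [B]} (ha : Det a) (hb : Det b) {x y z : Γ ⟶ [R]} (hx : Det x)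
    (hy : Det y) (hz : Det z) :
    ite' (andB b a) x (ite' b y z) = ite' b (ite' a x y) z := by
  have h : ite' a x (ite' b y z) = ite' b (ite' a x y) (ite' a x z) := by
    conv_lhs => rw [← ite_idem b hx]
    exact ite_ite ha hb x x y z
  rw [andB, ite_and _ _ _ (hb.ite' hy hz), ite_guard_right hb, h, ite_guard_left hb]

theorem iteW_and_ite {n : ℕ} {a b : Γ ⟶ [B]} (ha : Det a) (hb : Det b) {x y z : Γ ⟶ Rw n}
    (hx : Det x) (hy : Det y) (hz : Det z) :
    iteW n (andB b a) x (iteW n b y z) = iteW n b (iteW n a x y) z := by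
  induction n with
  | zero => exact eq_of_Rw_zero
  | succ n ih =>
    obtain ⟨x₀, x', hx₀, hx', rfl⟩ := hx.exists_consR
    obtain ⟨y₀, y', hy₀, hy', rfl⟩ := hy.exists_consR
    obtain ⟨z₀, z', hz₀, hz', rfl⟩ := hz.exists_consR
    rw [iteW_succ hb, iteW_succ ha, iteW_succ hb, iteW_succ (hb.andB ha), ih hx' hy' hz',
      ite_and_ite ha hb hx₀ hy₀ hz₀]

/-- Disjunction of guards. -/
def orB (a b : Γ ⟶ [B]) : Γ ⟶ [B] := notB (andB (notB a) (notB b))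

theorem Det.orB {a b : Γ ⟶ [B]} (ha : Det a) (hb : Det b) : Det (orB a b) :=
  (ha.notB.andB hb.notB).notB

/-- In the branch where `g` fails, the guard `g ∨ h` can be replaced by `h`. -/
theorem ite_or_ite {g h : Γ ⟶ [B]} (hg : Det g) {x y z : Γ ⟶ [R]} (hy : Det y) :
    ite' g x (ite' (orB g h) y z) = ite' g x (ite' h y z) := by
  have h1 : ite' (orB g h) y z = ite' g y (ite' h y z) := by
    rw [orB, notB, ite_not, andB, ite_and _ _ _ hy, notB, ite_not, notB, ite_not]
  rw [h1, ite_guard_right hg]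

theorem iteW_or_ite {n : ℕ} {g h : Γ ⟶ [B]} (hg : Det g) (hh : Det h) {x y z : Γ ⟶ Rw n}
    (hx : Det x) (hy : Det y) (hz : Det z) :
    iteW n g x (iteW n (orB g h) y z) = iteW n g x (iteW n h y z) := by
  induction n with
  | zero => exact eq_of_Rw_zero
  | succ n ih =>
    obtain ⟨x₀, x', hx₀, hx', rfl⟩ := hx.exists_consR
    obtain ⟨y₀, y', hy₀, hy', rfl⟩ := hy.exists_consR
    obtain ⟨z₀, z', hz₀, hz', rfl⟩ := hz.exists_consR
    rw [iteW_succ hh, iteW_succ hg, iteW_succ (hg.orB hh), iteW_succ hg, ih hx' hy' hz',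
      ite_or_ite hg hy₀]

end Gates

end CGM

/-! ### Mixtures form a convex algebra -/

namespace CGM

open Col Circ CategoryTheory MonoidalCategory
open scoped CGM.Circ ComonObj

set_option linter.unusedSectionVars false

section Convex

variable {Γ : List Col} [ComonObj Γ]

theorem eq_of_id_eq {C : Type*} [Category C] {a b : C} {e : a ⟶ a} {f g : a ⟶ b} (he : 𝟙 a = e)
    (h : e ≫ f = e ≫ g) : f = g := by
  rwa [← he, Category.id_comp, Category.id_comp] at h

/-- `andCirc` as a morphism between tensor products. -/
def andGate : ([B] ⊗ [B] : List Col) ⟶ [B] ⊗ [B] := hom andCirc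

/-- `orCirc` as a morphism between tensor products. -/
def orGate : ([B] ⊗ [B] : List Col) ⟶ [B] ⊗ [B] := hom orCirc

/-- The coin as a morphism from the unit. -/
def flipGate (p : unitInterval) : 𝟙_ (List Col) ⟶ [B] := hom (flip p)

/-- Two independent coins as a morphism from the unit. -/
def flipsGate (p q : unitInterval) : 𝟙_ (List Col) ⟶ [B] ⊗ [B] := hom (flip p ⊠ flip q)

theorem pair_andCirc [IsCommComonObj Γ] {b : Γ ⟶ [B]} (hb : Det b) (a : Γ ⟶ [B]) :
    pair b a ≫ andGate = pair (andB b a) b := by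
  have hb' : b ≫ Δ[[B]] = pair b b := hb
  have h : andGate =
      (((Δ[[B]] ▷ [B]) : _ ⟶ ([B] ⊗ ([B] ⊗ [B]) : List Col)) ≫
        ([B] ◁ (β_ [B] [B]).hom : _ ⟶ (([B] ⊗ [B]) ⊗ [B] : List Col))) ≫
      (hom andg : ([B] ⊗ [B] : List Col) ⟶ [B]) ▷ [B] := rfl
  have h1 : pair b a ≫ Δ[[B]] ▷ [B] = pair (Y := [B] ⊗ [B]) b (pair b a) := by
    rw [pair_whiskerRight, hb']
    exact pair_assoc_singleton b b a
  have h2 : pair (Y := [B] ⊗ [B]) b (pair b a) ≫ [B] ◁ (β_ [B] [B]).hom =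
      pair (X := [B] ⊗ [B]) (pair b a) b := by
    rw [pair_whiskerLeft, pair_braiding]
    exact (pair_assoc_singleton b a b).symm
  rw [h]
  exact comp_three_eq h1 h2 (pair_whiskerRight _ _ _)

theorem pair_orCirc {g : Γ ⟶ [B]} (hg : Det g) (h : Γ ⟶ [B]) :
    pair g h ≫ orGate = pair g (orB g h) := by
  have hg' : g ≫ Δ[[B]] = pair g g := hg
  have hc : orGate =
      ((Δ[[B]] ▷ [B]) : _ ⟶ ([B] ⊗ ([B] ⊗ [B]) : List Col)) ≫
        [B] ◁ (((hom notg ⊗ₘ hom notg) ≫ (hom andg : ([B] ⊗ [B] : List Col) ⟶ [B])) ≫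
          hom notg) := rfl
  have h1 : pair g h ≫ Δ[[B]] ▷ [B] = pair (Y := [B] ⊗ [B]) g (pair g h) := by
    rw [pair_whiskerRight, hg']
    exact pair_assoc_singleton g g h
  rw [hc]
  refine comp_two_eq h1 ?_
  rw [pair_whiskerLeft, ← Category.assoc, ← Category.assoc, pair_tensorHom]
  rfl

/-- The law `ifte b x x = x` as an equation between circuits: evaluation at the projections of
`[B] ⊗ Rw n`. -/
theorem idem_gate (n : ℕ) : [B] ◁ Δ[Rw n] ≫ iteGateW n = proj₂ [B] (Rw n) := by
  have h := iteW_idem (Γ := [B] ⊗ Rw n) (det_proj₁ (X := [B]) (Y := Rw n))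
    (det_proj₂ (X := [B]) (Y := Rw n))
  have hx : proj₂ [B] (Rw n) ≫ Δ[Rw n] = pair (proj₂ [B] (Rw n)) (proj₂ [B] (Rw n)) := det_proj₂
  rwa [iteW, ← hx, ← pair_whiskerLeft, pair_proj, Category.id_comp] at h

theorem iteW_self {n : ℕ} (b : Γ ⟶ [B]) {x : Γ ⟶ Rw n} (hx : Det x) : iteW n b x x = x := by
  have hx' : x ≫ Δ[Rw n] = pair x x := hx
  rw [iteW, ← hx', ← pair_whiskerLeft, Category.assoc, idem_gate, pair_proj₂]

/-- The law `ifte (not b) x y = ifte b y x` as an equation between circuits. -/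
theorem not_gate (n : ℕ) :
    hom notg ▷ (Rw n ⊗ Rw n) ≫ iteGateW n = [B] ◁ (β_ (Rw n) (Rw n)).hom ≫ iteGateW n := by
  have hb : Det (proj₁ [B] (Rw n ⊗ Rw n)) := det_proj₁
  have hz : Det (proj₂ [B] (Rw n ⊗ Rw n)) := det_proj₂
  have hx := hz.comp (det_proj₁ (X := Rw n) (Y := Rw n))
  have hy := hz.comp (det_proj₂ (X := Rw n) (Y := Rw n))
  refine eq_of_id_eq (pair_proj.symm.trans (congrArg (pair _) hz.eq_pair)) ?_
  rw [← Category.assoc, pair_whiskerRight, ← Category.assoc, pair_whiskerLeft, pair_braiding]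
  exact iteW_not hb hx hy

theorem iteW_notB {n : ℕ} (b : Γ ⟶ [B]) [IsCommComonObj Γ] (x y : Γ ⟶ Rw n) :
    iteW n (notB b) x y = iteW n b y x := by
  rw [notB, iteW, iteW, ← pair_whiskerRight, Category.assoc, not_gate, ← Category.assoc,
    pair_whiskerLeft, pair_braiding]

/-- A biased coin, tossed independently of the input. -/
def flipB (p : unitInterval) : Γ ⟶ [B] := ε[Γ] ≫ flipGate p

/-- Tossing a coin and placing it in front of `v`. -/
def addFlip (p : unitInterval) (v : List Col) : v ⟶ [B] ⊗ v := flipGate p ▷ v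

theorem pair_flipB {v : List Col} (p : unitInterval) (f : Γ ⟶ v) :
    pair (flipB p) f = f ≫ addFlip p v := by
  rw [flipB, ← pair_whiskerRight]
  exact congrArg (· ≫ _) (pair_unit_left _ _)

theorem iteW_flip_one [IsCommComonObj Γ] {n : ℕ} (x y : Γ ⟶ Rw n) :
    iteW n (flipB 1) x y = x := by
  have hx : Det (proj₁ (Rw n) (Rw n)) := det_proj₁
  have hy : Det (proj₂ (Rw n) (Rw n)) := det_proj₂
  have h : iteW n (flipB 1) _ _ = _ := iteW_true hx hy
  rw [iteW, pair_flipB, pair_proj, Category.id_comp] at h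
  rw [iteW, pair_flipB, Category.assoc, h, pair_proj₁]

theorem flipB_eq_notB (p : unitInterval) :
    flipB (Γ := Γ) p = notB (flipB (unitInterval.symm p)) := by
  have h : hom (flip p) = hom (flip (unitInterval.symm p) ⨟ notg) :=
    eqv_ax (.bool (p := 0) (q := 1) _ _ trivial ⟨trivial, trivial⟩ (flip_sem_eq_not p))
  rw [flipB, notB, flipB, Category.assoc]
  exact congrArg (ε[Γ] ≫ ·) h

/-- The circuit `(g, h, x, y, z) ↦ ifte g x (ifte h y z)` on words. -/
def selRight (n : ℕ) : (([B] ⊗ [B]) ⊗ (Rw n ⊗ (Rw n ⊗ Rw n)) : List Col) ⟶ Rw n :=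
  (α_ _ _ _).hom ≫ [B] ◁ ((α_ _ _ _).inv ≫ (β_ [B] (Rw n)).hom ▷ (Rw n ⊗ Rw n) ≫
    (α_ _ _ _).hom ≫ Rw n ◁ iteGateW n) ≫ iteGateW n

/-- The circuit `(b, a, x, y, z) ↦ ifte b (ifte a x y) z` on words. -/
def selLeft (n : ℕ) : (([B] ⊗ [B]) ⊗ (Rw n ⊗ (Rw n ⊗ Rw n)) : List Col) ⟶ Rw n :=
  (α_ _ _ _).hom ≫ [B] ◁ ([B] ◁ (α_ _ _ _).inv ≫ (α_ _ _ _).inv ≫ iteGateW n ▷ Rw n) ≫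
    iteGateW n

variable [IsCommComonObj Γ]

/-! In the next two lemmas, the components of the tuple need not be deterministic, because
`selRight` and `selLeft` use each of their inputs once. -/

theorem pair_selRight {n : ℕ} (g h : Γ ⟶ [B]) (x y z : Γ ⟶ Rw n) :
    pair (pair g h) (pair x (pair y z)) ≫ selRight n = iteW n g x (iteW n h y z) := by
  rw [selRight, ← Category.assoc, pair_associator_hom, ← Category.assoc, pair_whiskerLeft,
    ← Category.assoc, pair_associator_inv, ← Category.assoc, pair_whiskerRight, pair_braiding,
    ← Category.assoc, pair_associator_hom, pair_whiskerLeft]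
  rfl

theorem pair_selLeft {n : ℕ} (b a : Γ ⟶ [B]) (x y z : Γ ⟶ Rw n) :
    pair (pair b a) (pair x (pair y z)) ≫ selLeft n = iteW n b (iteW n a x y) z := by
  rw [selLeft, ← Category.assoc, pair_associator_hom, ← Category.assoc, pair_whiskerLeft,
    ← Category.assoc, pair_whiskerLeft, pair_associator_inv, ← Category.assoc,
    pair_associator_inv, pair_whiskerRight]
  rfl

/-- The identity of `B B R^n R^n R^n` is the tuple of its five projections, which are deterministic. By
`eq_of_id_eq`, an equation between circuits on this word can be checked on these projections. -/
theorem exists_generic (n : ℕ) :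
    ∃ (a b : (([B] ⊗ [B]) ⊗ (Rw n ⊗ (Rw n ⊗ Rw n)) : List Col) ⟶ [B])
      (x y z : (([B] ⊗ [B]) ⊗ (Rw n ⊗ (Rw n ⊗ Rw n)) : List Col) ⟶ Rw n),
      Det a ∧ Det b ∧ Det x ∧ Det y ∧ Det z ∧
      𝟙 (([B] ⊗ [B]) ⊗ (Rw n ⊗ (Rw n ⊗ Rw n)) : List Col) =
        pair (pair a b) (pair x (pair y z)) := by
  have hB : Det (proj₁ ([B] ⊗ [B]) (Rw n ⊗ (Rw n ⊗ Rw n))) := det_proj₁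
  have hX : Det (proj₂ ([B] ⊗ [B]) (Rw n ⊗ (Rw n ⊗ Rw n))) := det_proj₂
  have hY := hX.comp (det_proj₂ (X := Rw n) (Y := Rw n ⊗ Rw n))
  exact ⟨_, _, _, _, _, hB.comp det_proj₁, hB.comp det_proj₂, hX.comp det_proj₁,
    hY.comp det_proj₁, hY.comp det_proj₂, by
      rw [← hB.eq_pair, ← hY.eq_pair, ← hX.eq_pair, pair_proj]⟩

theorem andGate_selRight (n : ℕ) :
    andGate ▷ (Rw n ⊗ (Rw n ⊗ Rw n)) ≫ selRight n = selLeft n := by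
  obtain ⟨b, a, x, y, z, hb, ha, hx, hy, hz, h⟩ := exists_generic n
  refine eq_of_id_eq h ?_
  rw [pair_selLeft, ← Category.assoc, pair_whiskerRight, pair_andCirc hb, pair_selRight,
    iteW_and_ite ha hb hx hy hz]

theorem orGate_selRight (n : ℕ) :
    orGate ▷ (Rw n ⊗ (Rw n ⊗ Rw n)) ≫ selRight n = selRight n := by
  obtain ⟨g, k, x, y, z, hg, hk, hx, hy, hz, h⟩ := exists_generic n
  refine eq_of_id_eq h ?_
  rw [pair_selRight, ← Category.assoc, pair_whiskerRight, pair_orCirc hg, pair_selRight,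
    iteW_or_ite hg hk hx hy hz]

theorem pair_flipB_flipB (p q : unitInterval) :
    pair (flipB (Γ := Γ) p) (flipB q) = ε[Γ] ≫ flipsGate p q := by
  rw [flipB, flipB, ← pair_tensorHom]
  exact congrArg (· ≫ _) (pair_unit_left _ _)

/-- Both sides are nested choices between `x`, `y`, `z`. The left one uses the guards `(b ∧ a, b)` in
`selRight`, the right one the guards `(g, g ∨ h)`, and these have the same law. -/
theorem iteW_skew {n : ℕ} {p q p' q' : unitInterval} (h₁ : (p' : ℝ) = p * q)
    (h₂ : (q : ℝ) * (1 - p) = q' * (1 - p')) (x y z : Γ ⟶ Rw n) :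
    iteW n (flipB q) (iteW n (flipB p) x y) z = iteW n (flipB p') x (iteW n (flipB q') y z) := by
  have h : flipsGate q p ≫ andGate = flipsGate p' q' ≫ orGate :=
    eqv_ax (.bool (p := 0) (q := 2) _ _
      ⟨⟨trivial, trivial⟩, ⟨⟨trivial, trivial⟩, trivial, trivial⟩, trivial, trivial⟩
      ⟨⟨trivial, trivial⟩, ⟨trivial, trivial⟩, trivial, ⟨⟨trivial, trivial⟩, trivial⟩, trivial⟩
      (andCirc_orCirc_sem h₁ h₂))
  rw [← pair_selLeft, ← andGate_selRight, ← Category.assoc, pair_whiskerRight,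
    pair_flipB_flipB, Category.assoc, h, ← Category.assoc, ← pair_flipB_flipB,
    ← pair_whiskerRight, Category.assoc, orGate_selRight, pair_selRight]

end Convex

/-- The operation that `mix` induces on circuits modulo the theory. -/
def mixOp {m n : ℕ} (p : unitInterval) (f g : Rw m ⟶ Rw n) : Rw m ⟶ Rw n :=
  iteW n (flipB p) f g

theorem hom_mix {m n : ℕ} (p : unitInterval) (c d : Circ (Rw m) (Rw n)) :
    hom (mix p c d) = mixOp p (hom c) (hom d) := by
  have h : hom (flip p ⊠ c ⊠ d) = (hom c ⊗ₘ hom d) ≫ addFlip p (Rw n ⊗ Rw n) := by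
    have h1 : hom (flip p ⊠ c ⊠ d) = hom ((idw [] ⨟ flip p) ⊠ ((c ⊠ d) ⨟ idw _)) :=
      hom_par_congr (Category.id_comp (hom (flip p))).symm
        (Category.comp_id (hom (c ⊠ d))).symm
    rw [h1, ← hom_eq_iff.2 (Eqv.interchange (idw []) (flip p) (c ⊠ d) (idw _)), hom_seq,
      hom_eq_iff.2 (Eqv.nil_par (c ⊠ d))]
    rfl
  rw [mixOp, iteW, pair_flipB, mix, hom_seq, hom_seq, h, ← comul_Rw, ← Category.assoc]
  rfl

theorem mixOp_one {m n : ℕ} (f g : Rw m ⟶ Rw n) : mixOp 1 f g = f := iteW_flip_one f g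

/-- Idempotency for an arbitrary `f`, which need not be deterministic: by `ifte_natural` it reduces to
the identity. -/
theorem mixOp_self {m n : ℕ} (p : unitInterval) (f : Rw m ⟶ Rw n) : mixOp p f f = f := by
  obtain ⟨c, rfl⟩ := exists_hom f
  have h := iteW_comp c (flipB p) (𝟙 (Rw m)) (𝟙 (Rw m))
  rw [iteW_self _ det_id, Category.id_comp] at h
  exact h.symm

theorem mixOp_symm {m n : ℕ} (p : unitInterval) (f g : Rw m ⟶ Rw n) :
    mixOp p f g = mixOp (unitInterval.symm p) g f := by
  rw [mixOp, flipB_eq_notB, iteW_notB, mixOp]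

theorem mixOp_skew {m n : ℕ} {p q p' q' : unitInterval} (h₁ : (p' : ℝ) = p * q)
    (h₂ : (q : ℝ) * (1 - p) = q' * (1 - p')) (x y z : Rw m ⟶ Rw n) :
    mixOp q (mixOp p x y) z = mixOp p' x (mixOp q' y z) := iteW_skew h₁ h₂ x y z

end CGM

/-! ### Uniqueness of convex combinations -/

namespace CGM

section ConvexAlgebra

variable {K H : Type*}

/-- Formal convex combinations: `IsMix op leaf w a` says that `a` is obtained by iterated binary
mixing from leaves, where the total weight of the leaves with label `k` is `w k`. -/
inductive IsMix (op : unitInterval → H → H → H) (leaf : K → H → Prop) : (K →₀ ℝ) → H → Prop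
  | leaf (k : K) (a : H) : leaf k a → IsMix op leaf (Finsupp.single k 1) a
  | mix (p : unitInterval) (w w' : K →₀ ℝ) (a b : H) : 0 < p → p < 1 → IsMix op leaf w a →
      IsMix op leaf w' b → IsMix op leaf ((p : ℝ) • w + (1 - p : ℝ) • w') (op p a b)

/-- The laws of convex algebras. -/
structure ConvexLaws (op : unitInterval → H → H → H) : Prop where
  one (a b : H) : op 1 a b = a
  self (p : unitInterval) (a : H) : op p a a = a
  symm (p : unitInterval) (a b : H) : op p a b = op (unitInterval.symm p) b a
  skew {p q p' q' : unitInterval} (h₁ : (p' : ℝ) = p * q) (h₂ : (q : ℝ) * (1 - p) = q' * (1 - p'))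
    (a b c : H) : op q (op p a b) c = op p' a (op q' b c)

namespace ConvexLaws

variable {op : unitInterval → H → H → H} (L : ConvexLaws op)
include L

theorem zero (a b : H) : op 0 a b = b := by
  rw [L.symm, unitInterval.symm_zero, L.one]

/-- Two occurrences of `g` in nested mixtures can be joined. -/
theorem absorb {p r q : unitInterval} (hq : (q : ℝ) = p + r * (1 - p)) (g b : H) :
    op p g (op r g b) = op q g b := by
  rcases eq_or_lt_of_le p.2.1 with hp' | hp'
  · obtain rfl : p = 0 := Subtype.ext hp'.symm
    obtain rfl : q = r := Subtype.ext (by simpa using hq)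
    exact L.zero _ _
  have hr := r.2
  have hp1 := p.2.2
  have hq0 : (0 : ℝ) < q := by rw [hq]; nlinarith [hr.1]
  have hs : (p : ℝ) / q ∈ unitInterval := by
    refine ⟨by positivity, (div_le_one hq0).2 ?_⟩
    rw [hq]; nlinarith [hr.1]
  rw [← L.skew (p := ⟨(p : ℝ) / q, hs⟩) (q := q) (p' := p) (q' := r), L.self]
  · simp only; field_simp
  · simp only; field_simp; rw [hq]; ring

/-- In a mixture of mixtures, the occurrences of `g` can be collected in front. -/
theorem entropic {p r s P : unitInterval} (hp1 : p < 1) (hr1 : r < 1) (hs1 : s < 1)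
    (hP : (P : ℝ) = p * r + (1 - p) * s) (g a b : H) :
    ∃ Q : unitInterval, (1 - P : ℝ) * Q = p * (1 - r) ∧ (1 - P : ℝ) * (1 - Q) = (1 - p) * (1 - s) ∧
      op p (op r g a) (op s g b) = op P g (op Q a b) := by
  have hp0' : (0 : ℝ) ≤ p := p.2.1
  have hp1' : (p : ℝ) < 1 := hp1
  have hr0' : (0 : ℝ) ≤ r := r.2.1
  have hr1' : (r : ℝ) < 1 := hr1
  have hs0' : (0 : ℝ) ≤ s := s.2.1
  have hs1' : (s : ℝ) < 1 := hs1
  have hpr : (p * r : ℝ) < 1 := by nlinarith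
  have e1 : 0 < 1 - (p * r : ℝ) := by linarith
  obtain ⟨q₁, hq₁⟩ : ∃ q₁ : unitInterval, (p : ℝ) * (1 - r) = q₁ * (1 - p * r) := by
    refine ⟨⟨p * (1 - r) / (1 - p * r), div_nonneg (by nlinarith) e1.le,
      (div_le_one e1).2 (by nlinarith)⟩, ?_⟩
    simp only; field_simp
  have hq₁1 := q₁.2.2
  have hq₁0 := q₁.2.1
  have ht : (1 - q₁ : ℝ) * s < 1 := by nlinarith
  have e2 : 0 < 1 - (1 - q₁ : ℝ) * s := by linarith
  obtain ⟨q₂, hq₂⟩ : ∃ q₂ : unitInterval,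
      (1 - q₁ : ℝ) * (1 - s) = q₂ * (1 - (1 - q₁) * s) := by
    refine ⟨⟨(1 - q₁ : ℝ) * (1 - s) / (1 - (1 - q₁) * s), div_nonneg (by nlinarith) e2.le,
      (div_le_one e2).2 (by nlinarith)⟩, ?_⟩
    simp only; field_simp
  have hP' : (P : ℝ) = p * r + (1 - q₁) * s * (1 - p * r) := by
    rw [hP]; linear_combination (-s : ℝ) * hq₁
  refine ⟨unitInterval.symm q₂, ?_, ?_, ?_⟩
  · rw [unitInterval.coe_symm_eq, hP']
    linear_combination (1 - p * r : ℝ) * hq₂ - hq₁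
  · rw [unitInterval.coe_symm_eq, hP']
    linear_combination (-(1 - p * r : ℝ)) * hq₂ + (1 - s : ℝ) * hq₁
  · rw [L.skew (p := r) (q := p) (p' := p * r) (q' := q₁) (by simp [mul_comm]) (by simpa using hq₁),
      L.symm q₁, L.skew (p := s) (q := unitInterval.symm q₁) (p' := unitInterval.symm q₁ * s)
        (q' := q₂) (by simp [mul_comm]) (by simpa using hq₂), L.symm q₂]
    exact L.absorb (by rw [hP']; simp) _ _

end ConvexLaws

section Uniqueness

variable {op : unitInterval → H → H → H} {leaf : K → H → Prop}

theorem IsMix.nonneg {w : K →₀ ℝ} {a : H} (h : IsMix op leaf w a) (k : K) : 0 ≤ w k := by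
  induction h with
  | leaf j a _ =>
    classical
    rw [Finsupp.single_apply]
    split_ifs <;> norm_num
  | mix p w w' a b _ _ _ _ ih ih' =>
    have := p.2.1
    have := p.2.2
    simp only [Finsupp.add_apply, Finsupp.smul_apply, smul_eq_mul]
    have : (0 : ℝ) ≤ 1 - p := by linarith
    positivity

theorem IsMix.exists_leaf {w : K →₀ ℝ} {a : H} (h : IsMix op leaf w a) :
    ∃ k g, leaf k g ∧ w k ≠ 0 := by
  induction h with
  | leaf j a ha => exact ⟨j, a, ha, by simp⟩
  | mix p w w' a b hp0 hp1 h h' ih ih' =>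
    obtain ⟨k, g, hg, hk⟩ := ih
    refine ⟨k, g, hg, ?_⟩
    have h1 : (0 : ℝ) < w k := lt_of_le_of_ne (h.nonneg k) hk.symm
    have h2 := h'.nonneg k
    have h3 : (0 : ℝ) < p := hp0
    have h4 : (0 : ℝ) ≤ 1 - p := by linarith [p.2.2]
    simp only [Finsupp.add_apply, Finsupp.smul_apply, smul_eq_mul]
    positivity

/-- A mixture either is the leaf `g` or is a mixture of `g` and of a mixture without `g`. -/
theorem IsMix.extract (L : ConvexLaws op) (hleaf : ∀ k a b, leaf k a → leaf k b → a = b) {k : K}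
    {g : H} (hg : leaf k g) {w : K →₀ ℝ} {a : H} (h : IsMix op leaf w a) :
    (w = Finsupp.single k 1 ∧ a = g) ∨
    ∃ (r : unitInterval) (w' : K →₀ ℝ) (a' : H), r < 1 ∧ IsMix op leaf w' a' ∧ w' k = 0 ∧
      a = op r g a' ∧ w = (r : ℝ) • Finsupp.single k 1 + (1 - r : ℝ) • w' := by
  -- Mixing `g` into a mixture of the desired form only changes the weight of `g`.
  have step {p r : unitInterval} (hp1 : p < 1) (hr1 : r < 1) (w' : K →₀ ℝ) (a' : H) :
      ∃ P : unitInterval, P < 1 ∧ op p g (op r g a') = op P g a' ∧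
        (p : ℝ) • Finsupp.single k (1 : ℝ) + (1 - p : ℝ) •
          ((r : ℝ) • Finsupp.single k 1 + (1 - r : ℝ) • w') =
        (P : ℝ) • Finsupp.single k 1 + (1 - P : ℝ) • w' := by
    have hp0 := p.2.1
    have hp1' : (p : ℝ) < 1 := hp1
    have hr0 := r.2.1
    have hr1' : (r : ℝ) < 1 := hr1
    have hP0 : (0 : ℝ) ≤ p + r * (1 - p) := by nlinarith
    have hP1 : (p + r * (1 - p) : ℝ) < 1 := by nlinarith
    refine ⟨⟨p + r * (1 - p), hP0, hP1.le⟩, hP1, L.absorb rfl _ _, ?_⟩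
    ext j
    simp only [Finsupp.add_apply, Finsupp.smul_apply, smul_eq_mul]
    ring
  induction h with
  | leaf j a ha =>
    by_cases hjk : j = k
    · subst hjk
      exact .inl ⟨rfl, hleaf _ _ _ ha hg⟩
    · refine .inr ⟨0, _, a, zero_lt_one, .leaf j a ha, ?_, (L.zero g a).symm, by simp⟩
      exact Finsupp.single_eq_of_ne' hjk
  | mix p w w' a b hp0 hp1 h h' ih ih' =>
    have hp0' : (0 : ℝ) < p := hp0
    have hp1' : (p : ℝ) < 1 := hp1
    have hs0 : 0 < unitInterval.symm p := Subtype.mk_lt_mk.2 (by simpa using hp1')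
    have hs1 : unitInterval.symm p < 1 := Subtype.mk_lt_mk.2 (by simpa using hp0')
    rcases ih with ⟨rfl, rfl⟩ | ⟨r, v, a', hr1, hv, hvk, rfl, rfl⟩
    · rcases ih' with ⟨rfl, rfl⟩ | ⟨s, v', b', hs1, hv', hvk', rfl, rfl⟩
      · refine .inl ⟨?_, L.self _ _⟩
        rw [← add_smul]; simp
      · obtain ⟨P, hP1, hP, hw⟩ := step hp1 hs1 v' b'
        exact .inr ⟨P, v', b', hP1, hv', hvk', hP, hw⟩
    · rcases ih' with ⟨rfl, rfl⟩ | ⟨s, v', b', hs1, hv', hvk', rfl, rfl⟩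
      · obtain ⟨P, hP1, hP, hw⟩ := step hs1 hr1 v a'
        refine .inr ⟨P, v, a', hP1, hv, hvk, ?_, ?_⟩
        · rw [L.symm, hP]
        · rw [← hw, add_comm]; simp
      · have hr1' : (r : ℝ) < 1 := hr1
        have hs1' : (s : ℝ) < 1 := hs1
        have hP0 : (0 : ℝ) ≤ p * r + (1 - p) * s := by
          nlinarith [mul_nonneg hp0'.le r.2.1, mul_nonneg (sub_nonneg.2 hp1'.le) s.2.1]
        have hP1 : (p * r + (1 - p) * s : ℝ) < 1 := by nlinarith
        obtain ⟨Q, hQ, hQ', hop⟩ := L.entropic (P := ⟨p * r + (1 - p) * s, hP0, hP1.le⟩)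
          hp1 hr1 hs1 rfl g a' b'
        simp only at hQ hQ'
        have h1P : (0 : ℝ) < 1 - (p * r + (1 - p) * s) := by linarith
        have hQ0 : (0 : ℝ) < Q := by
          have : (0 : ℝ) < p * (1 - r) := mul_pos hp0' (by linarith)
          rw [← hQ] at this
          exact (mul_pos_iff_of_pos_left h1P).1 this
        have hQ1 : (Q : ℝ) < 1 := by
          have : (0 : ℝ) < (1 - p) * (1 - s) := mul_pos (by linarith) (by linarith)
          rw [← hQ'] at this
          linarith [(mul_pos_iff_of_pos_left h1P).1 this]
        refine .inr ⟨_, _, _, hP1, .mix Q _ _ _ _ hQ0 hQ1 hv hv', by simp [hvk, hvk'], hop, ?_⟩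
        ext j
        simp only [Finsupp.add_apply, Finsupp.smul_apply, smul_eq_mul]
        linear_combination (-v j) * hQ - (v' j) * hQ'

/-- A mixture is determined by its weights. The induction is on the number of leaves with nonzero
weight: one of them is extracted from both sides, with the same weight. -/
theorem IsMix.unique (L : ConvexLaws op) (hleaf : ∀ k a b, leaf k a → leaf k b → a = b)
    {w : K →₀ ℝ} {a b : H} (h : IsMix op leaf w a) (h' : IsMix op leaf w b) : a = b := by
  induction hn : w.support.card using Nat.strong_induction_on generalizing w a b with
  | _ n ih =>
    obtain ⟨k, g, hg, hk⟩ := h.exists_leaf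
    rcases h.extract L hleaf hg with ⟨hw, rfl⟩ | ⟨r, v, a', hr1, hv, hvk, rfl, hw⟩
    · rcases h'.extract L hleaf hg with ⟨_, rfl⟩ | ⟨s, v', b', hs1, hv', hvk', rfl, hw'⟩
      · rfl
      · have h1 : w k = 1 := by simp [hw]
        have h2 : w k = s := by simp [hw', hvk']
        exact absurd hs1 (by rw [← Subtype.coe_lt_coe, ← h2, h1]; exact lt_irrefl 1)
    · rcases h'.extract L hleaf hg with ⟨hw', rfl⟩ | ⟨s, v', b', hs1, hv', hvk', rfl, hw'⟩
      · have h1 : w k = 1 := by simp [hw']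
        have h2 : w k = r := by simp [hw, hvk]
        exact absurd hr1 (by rw [← Subtype.coe_lt_coe, ← h2, h1]; exact lt_irrefl 1)
      · have h1 : w k = r := by simp [hw, hvk]
        have h2 : w k = s := by simp [hw', hvk']
        obtain rfl : r = s := Subtype.ext (h1.symm.trans h2)
        have hr1' : (r : ℝ) < 1 := hr1
        have hvv : v = v' := by
          have := add_left_cancel (hw.symm.trans hw')
          exact smul_right_injective _ (sub_ne_zero.2 hr1'.ne') this
        subst hvv
        rw [ih _ ?_ hv hv' rfl]
        rw [← hn]
        refine Finset.card_lt_card ⟨fun j hj => ?_, fun hsub => ?_⟩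
        · rw [Finsupp.mem_support_iff] at hj ⊢
          by_cases hjk : j = k
          · rwa [hjk]
          · have : w j = (1 - r) * v j := by
              rw [hw]; simp [Finsupp.single_eq_of_ne hjk]
            rw [this]
            exact mul_ne_zero (sub_ne_zero.2 hr1'.ne') hj
        · exact (Finsupp.mem_support_iff.1 (hsub (Finsupp.mem_support_iff.2 hk))) hvk

end Uniqueness

end ConvexAlgebra

end CGM

/-! ### The laws of symmetric monoidal categories hold semantically -/

namespace CGM

open Col Circ
open scoped CGM.Circ ENNReal

/-- The list of the values carried by a word. Unlike the values themselves, these lists can be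
compared across words that are equal, but not definitionally so. -/
def toList : (v : List Col) → Val v → List (Bool ⊕ ℝ)
  | [], _ => []
  | B :: v, x => .inl x.1 :: toList v x.2
  | R :: v, x => .inr x.1 :: toList v x.2

theorem toList_injective : (v : List Col) → Function.Injective (toList v)
  | [], _, _, _ => rfl
  | B :: v, x, y, h => by
    obtain ⟨h₁, h₂⟩ := List.cons.inj h
    exact Prod.ext (Sum.inl.inj h₁) (toList_injective v h₂)
  | R :: v, x, y, h => by
    obtain ⟨h₁, h₂⟩ := List.cons.inj h
    exact Prod.ext (Sum.inr.inj h₁) (toList_injective v h₂)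

theorem toList_join : (v w : List Col) → (x : Val v) → (y : Val w) →
    toList (v ++ w) (join x y) = toList v x ++ toList w y
  | [], _, _, _ => rfl
  | B :: v, w, x, y => congrArg (Sum.inl x.1 :: ·) (toList_join v w x.2 y)
  | R :: v, w, x, y => congrArg (Sum.inr x.1 :: ·) (toList_join v w x.2 y)

/-- The only value of the empty word. -/
def nilVal : Val [] := ()

theorem toList_nil (x : Val []) : toList [] x = [] := rfl

/-- Transport of values along an equality of words. -/
def vcast {v w : List Col} (h : v = w) (x : Val v) : Val w := h ▸ x

theorem measurable_vcast {v w : List Col} (h : v = w) : Measurable (vcast h) := by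
  subst h; exact measurable_id

theorem vcast_eq {v w : List Col} (h : v = w) {x : Val v} {y : Val w}
    (hxy : toList v x = toList w y) : vcast h x = y := by
  subst h; exact toList_injective _ hxy

theorem lintegral_cast {v w v' w' : List Col} (hv : v = v') (hw : w = w') (c : Circ v w)
    {x : Val v} {x' : Val v'} (hx : toList v x = toList v' x') (F : Val w' → ℝ≥0∞) :
    ∫⁻ y, F y ∂(cast hv hw c).sem x' = ∫⁻ y, F (vcast hw y) ∂c.sem x := by
  subst hv hw
  rw [toList_injective _ hx]
  rfl

theorem cast_sem_dirac {v w v' w' : List Col} (hv : v = v') (hw : w = w') {c : Circ v w}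
    {x : Val v} {x' : Val v'} {y : Val w} {y' : Val w'} (hx : toList v x = toList v' x')
    (hy : toList w y = toList w' y') (h : c.sem x = Measure.dirac y) :
    (cast hv hw c).sem x' = Measure.dirac y' := by
  subst hv hw
  rw [← toList_injective _ hx, ← toList_injective _ hy]
  exact h

/-- Equality of the interpretations of two circuits whose types are equal. -/
def SemEq {v w v' w' : List Col} (c : Circ v w) (d : Circ v' w') : Prop :=
  ∃ (hv : v = v') (hw : w = w'), (cast hv hw c).sem = d.sem

theorem SemEq.of_eq {v w : List Col} {c d : Circ v w} (h : c.sem = d.sem) : SemEq c d :=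
  ⟨rfl, rfl, h⟩

theorem semEq_par_assoc {v₁ w₁ v₂ w₂ v₃ w₃ : List Col} (c : Circ v₁ w₁) (d : Circ v₂ w₂)
    (e : Circ v₃ w₃) : SemEq ((c ⊠ d) ⊠ e) (c ⊠ (d ⊠ e)) := by
  refine ⟨List.append_assoc _ _ _, List.append_assoc _ _ _, sem_ext fun x F hF => ?_⟩
  obtain ⟨x₁, x', rfl⟩ := exists_join x
  obtain ⟨x₂, x₃, rfl⟩ := exists_join x'
  have hF' : Measurable fun y => F (vcast (List.append_assoc w₁ w₂ w₃) y) :=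
    hF.comp (measurable_vcast _)
  rw [lintegral_cast (x := join (join x₁ x₂) x₃) _ _ _ (by simp [toList_join]),
    lintegral_par _ _ _ _ hF', lintegral_par _ _ _ _ hF, lintegral_par]
  · refine lintegral_congr fun y₁ => ?_
    rw [lintegral_par]
    · refine lintegral_congr fun y₂ => lintegral_congr fun y₃ => ?_
      rw [vcast_eq (y := join y₁ (join y₂ y₃)) _ (by simp [toList_join])]
    · exact hF.comp (measurable_join.comp measurable_prodMk_left)
  · exact Measurable.lintegral_prod_right
      (hF'.comp measurable_join)

theorem semEq_par_nil {v w : List Col} (c : Circ v w) : SemEq (c ⊠ idw []) c := by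
  refine ⟨List.append_nil _, List.append_nil _, sem_ext fun x F hF => ?_⟩
  have hF' : Measurable fun y => F (vcast (List.append_nil w) y) := hF.comp (measurable_vcast _)
  rw [lintegral_cast (x := join x nilVal) _ _ _ (by simp [toList_join, toList_nil]),
    lintegral_par _ _ _ _ hF']
  refine lintegral_congr fun y => ?_
  rw [idw_sem_apply, lintegral_dirac']
  · rw [vcast_eq _ (y := y) (by simp [toList_join, toList_nil])]
  · exact hF'.comp (measurable_join.comp measurable_prodMk_left)

theorem semEq_nil_par {v w : List Col} (c : Circ v w) : SemEq (idw [] ⊠ c) c := by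
  refine SemEq.of_eq (sem_ext fun x F hF => ?_)
  have h := lintegral_par (idw []) c nilVal x hF
  rw [idw_sem_apply [] nilVal, lintegral_dirac'] at h
  · exact h
  · exact Measurable.lintegral_prod_right (hF.comp measurable_join)

theorem id_par_id_sem (v w : List Col) : (idw v ⊠ idw w).sem = (idw (v ++ w)).sem := by
  ext1 x
  obtain ⟨y, z, rfl⟩ := exists_join x
  rw [idw_sem_apply]
  exact par_sem_dirac (idw_sem_apply _ _) (idw_sem_apply _ _)

theorem interchange_sem {u v w u' v' w' : List Col} (c : Circ u v) (d : Circ v w) (c' : Circ u' v')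
    (d' : Circ v' w') : ((c ⊠ c') ⨟ (d ⊠ d')).sem = ((c ⨟ d) ⊠ (c' ⨟ d')).sem := by
  refine sem_ext fun x F hF => ?_
  obtain ⟨x, x', rfl⟩ := exists_join x
  have h1 : ∀ y, Measurable fun z => F (join y z) :=
    fun y => hF.comp (measurable_join.comp measurable_prodMk_left)
  have hK : Measurable fun p : Val w × Val v' => ∫⁻ z', F (join p.1 z') ∂d'.sem p.2 :=
    Measurable.lintegral_kernel_prod_right' (κ := d'.sem.comap Prod.snd measurable_snd)
      (f := fun q : (Val w × Val v') × Val w' => F (join q.1.1 q.2))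
      (hF.comp (measurable_join.comp
        ((measurable_fst.comp measurable_fst).prodMk measurable_snd)))
  rw [lintegral_seq _ _ _ hF, lintegral_par _ _ _ _ hF.lintegral_kernel, lintegral_par _ _ _ _ hF,
    lintegral_seq]
  · refine lintegral_congr fun y => ?_
    simp only [lintegral_par _ _ _ _ hF, lintegral_seq _ _ _ (h1 _)]
    rw [lintegral_lintegral_swap]
    exact (hK.comp measurable_swap).aemeasurable
  · exact Measurable.lintegral_prod_right (hF.comp measurable_join)

theorem swap_natural_sem {v w v' w' : List Col} (c : Circ v w) (d : Circ v' w') :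
    ((c ⊠ d) ⨟ swap w w').sem = (swap v v' ⨟ (d ⊠ c)).sem := by
  refine sem_ext fun x F hF => ?_
  obtain ⟨x, x', rfl⟩ := exists_join x
  rw [lintegral_seq _ _ _ hF, lintegral_seq _ _ _ hF, lintegral_par _ _ _ _ hF.lintegral_kernel,
    swap_sem_apply, lintegral_dirac' _ hF.lintegral_kernel, lintegral_par _ _ _ _ hF]
  simp only [swap_sem_apply, lintegral_dirac' _ hF]
  exact lintegral_lintegral_swap
    (hF.comp (measurable_join.comp measurable_swap)).aemeasurable

theorem swap_swap_sem (v w : List Col) : (swap v w ⨟ swap w v).sem = (idw (v ++ w)).sem := by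
  ext1 x
  obtain ⟨y, z, rfl⟩ := exists_join x
  rw [idw_sem_apply]
  exact seq_sem_dirac (swap_sem_apply _ _) (swap_sem_apply _ _)

theorem semEq_swap_nil (v : List Col) : SemEq (swap v []) (idw v) := by
  refine ⟨List.append_nil _, rfl, ?_⟩
  ext1 x
  rw [idw_sem_apply]
  exact cast_sem_dirac (x := join x nilVal) _ _ (by simp [toList_join, toList_nil]) rfl
    (swap_sem_apply _ _)

theorem semEq_hexagon (u v w : List Col) : SemEq (swap u (v ++ w))
    ((swap u v ⊠ idw w) ⨟ cast (v' := (v ++ u) ++ w) (by simp) rfl (idw v ⊠ swap u w)) := by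
  refine ⟨(List.append_assoc _ _ _).symm, List.append_assoc _ _ _, ?_⟩
  ext1 x
  obtain ⟨x', z, rfl⟩ := exists_join x
  obtain ⟨x, y, rfl⟩ := exists_join x'
  have h1 : (swap u v ⊠ idw w).sem (join (join x y) z) = Measure.dirac (join (join y x) z) :=
    par_sem_dirac (swap_sem_apply _ _) (idw_sem_apply _ _)
  have h2 : (idw v ⊠ swap u w).sem (join y (join x z)) = Measure.dirac (join y (join z x)) :=
    par_sem_dirac (idw_sem_apply _ _) (swap_sem_apply _ _)
  rw [seq_sem_dirac h1 (cast_sem_dirac _ _ (by simp [toList_join]) rfl h2)]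
  exact cast_sem_dirac (x := join x (join y z)) _ _ (by simp [toList_join])
    (by simp [toList_join]) (swap_sem_apply _ _)

/-- Soundness of the laws of symmetric monoidal categories. -/
theorem Eqv.semEq {v w v' w' : List Col} {c : Circ v w} {d : Circ v' w'}
    (h : Eqv (fun _ _ _ _ => False) c d) : SemEq c d := by
  induction h with
  | ax h => exact h.elim
  | refl c => exact .of_eq rfl
  | symm _ ih =>
    obtain ⟨rfl, rfl, h⟩ := ih
    exact .of_eq h.symm
  | trans _ _ ih ih' =>
    obtain ⟨rfl, rfl, h⟩ := ih
    obtain ⟨rfl, rfl, h'⟩ := ih'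
    exact .of_eq (h.trans h')
  | seq_congr _ _ ih ih' =>
    obtain ⟨rfl, rfl, h⟩ := ih
    obtain ⟨_, rfl, h'⟩ := ih'
    refine .of_eq ?_
    rw [Circ.sem, Circ.sem, ← h, ← h']
    rfl
  | par_congr _ _ ih ih' =>
    obtain ⟨rfl, rfl, h⟩ := ih
    obtain ⟨rfl, rfl, h'⟩ := ih'
    refine .of_eq ?_
    rw [Circ.sem, Circ.sem, ← h, ← h']
    rfl
  | seq_assoc c d e => exact .of_eq (Kernel.comp_assoc _ _ _).symm
  | id_seq c => exact .of_eq (Kernel.comp_id _)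
  | seq_id c => exact .of_eq (Kernel.id_comp _)
  | par_assoc c d e => exact semEq_par_assoc c d e
  | nil_par c => exact semEq_nil_par c
  | par_nil c => exact semEq_par_nil c
  | id_par_id v w => exact .of_eq (id_par_id_sem v w)
  | interchange c d c' d' => exact .of_eq (interchange_sem c d c' d')
  | swap_natural c d => exact .of_eq (swap_natural_sem c d)
  | swap_swap v w => exact .of_eq (swap_swap_sem v w)
  | swap_nil v => exact semEq_swap_nil v
  | hexagon u v w => exact semEq_hexagon u v w

theorem SMCEq.sem_eq {v w : List Col} {c d : Circ v w} (h : SMCEq c d) : c.sem = d.sem := by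
  obtain ⟨_, _, h⟩ := Eqv.semEq h
  exact h

end CGM

/-! ### The semantics of mixtures -/

namespace CGM

open Col Circ
open scoped CGM.Circ ENNReal

/-- The value of a single wire. -/
def val1 (a : Col) (r : a.Ty) : Val [a] := ((r, ()) : a.Ty × Unit)

theorem exists_val1_join {a : Col} {v : List Col} (x : Val (a :: v)) :
    ∃ (r : a.Ty) (y : Val v), x = join (val1 a r) y := ⟨x.1, x.2, rfl⟩

theorem toList_cons_join {a : Col} {v w : List Col} (x : Val (a :: v)) (y : Val w) :
    toList (a :: (v ++ w)) (join x y) = toList (a :: v) x ++ toList w y := toList_join (a :: v) w x y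

theorem copy_sem_val1 (a : Col) (r : a.Ty) :
    (copy a).sem (val1 a r) = Measure.dirac (join (val1 a r) (val1 a r)) := by
  rw [Circ.sem, Gen.sem]
  exact Kernel.deterministic_apply _ _

theorem ifte_sem_val1 (b : Bool) (r s : ℝ) :
    ifte.sem (join (bval b) (join (val1 R r) (val1 R s))) =
      Measure.dirac (if b then val1 R r else val1 R s) := by
  rw [Circ.sem, Gen.sem]
  refine (Kernel.deterministic_apply _ _).trans ?_
  cases b <;> rfl

/-- `copyW` copies its input. -/
theorem copyW_sem (v : List Col) (x : Val v) : (copyW v).sem x = Measure.dirac (join x x) := by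
  induction v with
  | nil => exact idw_sem_apply _ _
  | cons a v ih =>
    obtain ⟨r, x, rfl⟩ := exists_val1_join x
    have h1 : (copy a ⊠ copyW v).sem (join (val1 a r) x) =
        Measure.dirac (join (join (val1 a r) (val1 a r)) (join x x)) :=
      par_sem_dirac (copy_sem_val1 a r) (ih x)
    have h2 : (swap [a] v ⊠ idw v).sem (join (join (val1 a r) x) x) =
        Measure.dirac (join (join x (val1 a r)) x) :=
      par_sem_dirac (swap_sem_apply _ _) (idw_sem_apply _ _)
    have h3 : (idw [a] ⊠ swap [a] v ⊠ idw v).sem (join (val1 a r) (join (join (val1 a r) x) x)) =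
        Measure.dirac (join (val1 a r) (join (join x (val1 a r)) x)) :=
      par_sem_dirac (idw_sem_apply _ _) h2
    refine seq_sem_dirac h1 (cast_sem_dirac _ _ ?_ ?_ h3)
    · have e1 := toList_cons_join (val1 a r) (val1 a r)
      have e2 := toList_join [a, a] (v ++ v) (join (val1 a r) (val1 a r)) (join x x)
      have e3 := toList_cons_join (val1 a r) (join (join (val1 a r) x : Val (a :: v)) x)
      have e4 := toList_cons_join (join (val1 a r) x : Val (a :: v)) x
      have e5 := toList_cons_join (val1 a r) x
      refine e3.trans (.trans ?_ e2.symm)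
      refine (congrArg _ (e4.trans (congrArg (· ++ _) e5))).trans ?_
      refine .trans ?_ (congrArg (· ++ _) e1).symm
      simp [toList_join]
    · have e1 := toList_cons_join (val1 a r) (join (join x (val1 a r)) x)
      have e2 := toList_cons_join (join (val1 a r) x : Val (a :: v)) (join (val1 a r) x : Val (a :: v))
      have e3 := toList_cons_join (val1 a r) x
      refine e1.trans (.trans ?_ e2.symm)
      refine .trans ?_ (congrArg₂ (· ++ ·) e3 e3).symm
      simp [toList_join]

/-- `ifteW` selects one of two tuples. -/
theorem ifteW_sem (n : ℕ) (b : Bool) (x y : Val (Rw n)) :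
    (ifteW n).sem (join (bval b) (join x y)) = Measure.dirac (if b then x else y) := by
  induction n using Nat.twoStepInduction with
  | zero =>
    rw [ifteW, Circ.sem, Gen.sem]
    refine (Kernel.deterministic_apply _ _).trans ?_
    rfl
  | one =>
    obtain ⟨r, x', rfl⟩ := exists_val1_join (a := R) (v := []) x
    obtain ⟨s, y', rfl⟩ := exists_val1_join (a := R) (v := []) y
    exact ifte_sem_val1 b r s
  | more n _ ih =>
    obtain ⟨r, x, rfl⟩ := exists_val1_join (a := R) (v := Rw (n + 1)) x
    obtain ⟨s, y, rfl⟩ := exists_val1_join (a := R) (v := Rw (n + 1)) y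
    have h1 : (copy B ⊠ idw (Rw (n + 2) ++ Rw (n + 2))).sem
        (join (bval b)
          (join (join (val1 R r) x) (join (val1 R s) y) : Val (Rw (n + 2) ++ Rw (n + 2)))) =
        Measure.dirac
          (join (join (bval b) (bval b))
            (join (join (val1 R r) x) (join (val1 R s) y) : Val (Rw (n + 2) ++ Rw (n + 2)))) :=
      par_sem_dirac (copy_sem_apply b) (idw_sem_apply _ _)
    have h2 : (swap [B] [R] ⊠ idw (Rw (n + 1) ++ Rw (n + 2))).sem
        (join (join (bval b) (val1 R r))
          (join x (join (val1 R s) y) : Val (Rw (n + 1) ++ Rw (n + 2)))) =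
        Measure.dirac
          (join (join (val1 R r) (bval b))
            (join x (join (val1 R s) y) : Val (Rw (n + 1) ++ Rw (n + 2)))) :=
      par_sem_dirac (swap_sem_apply _ _) (idw_sem_apply _ _)
    have h3 : (idw [B] ⊠ swap [B] [R] ⊠ idw (Rw (n + 1) ++ Rw (n + 2))).sem
        (join (bval b) (join (join (bval b) (val1 R r))
          (join x (join (val1 R s) y) : Val (Rw (n + 1) ++ Rw (n + 2))))) =
        Measure.dirac
          (join (bval b) (join (join (val1 R r) (bval b))
            (join x (join (val1 R s) y) : Val (Rw (n + 1) ++ Rw (n + 2))))) :=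
      par_sem_dirac (idw_sem_apply _ _) h2
    have h4 : (swap (B :: Rw (n + 1)) [R] ⊠ idw (Rw (n + 1))).sem
        (join (join (join (bval b) x : Val (B :: Rw (n + 1))) (val1 R s)) y) =
        Measure.dirac (join (join (val1 R s) (join (bval b) x : Val (B :: Rw (n + 1)))) y) :=
      par_sem_dirac (swap_sem_apply _ _) (idw_sem_apply _ _)
    have h5 : (idw [B, R] ⊠ swap (B :: Rw (n + 1)) [R] ⊠ idw (Rw (n + 1))).sem
        (join (join (bval b) (val1 R r))
          (join (join (join (bval b) x : Val (B :: Rw (n + 1))) (val1 R s)) y)) =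
        Measure.dirac (join (join (bval b) (val1 R r))
          (join (join (val1 R s) (join (bval b) x : Val (B :: Rw (n + 1)))) y)) :=
      par_sem_dirac (idw_sem_apply _ _) h4
    have h6 : (ifte ⊠ ifteW (n + 1)).sem
        (join (join (bval b) (join (val1 R r) (val1 R s))) (join (bval b) (join x y))) =
        Measure.dirac (join (if b then val1 R r else val1 R s) (if b then x else y)) :=
      par_sem_dirac (ifte_sem_val1 b r s) (ih x y)
    have h7 : (join (if b then val1 R r else val1 R s) (if b then x else y) : Val (Rw (n + 2))) =
        if b then join (val1 R r) x else join (val1 R s) y := by cases b <;> rfl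
    rw [h7] at h6
    rw [ifteW]
    -- The transport in `ifteW` leaves the list of values unchanged.
    refine seq_sem_dirac (seq_sem_dirac (seq_sem_dirac h1 h3) (cast_sem_dirac _ _ ?_ rfl h5)) h6
    have e1 := toList_cons_join (bval b) (val1 R r)
    have e2 := toList_cons_join (bval b) x
    have e3 := toList_cons_join (bval b) (join (join (val1 R r) (bval b)) (join x
      (join (val1 R s) y : Val (Rw (n + 2)))))
    have e4 := toList_join ([R] ++ [B]) (Rw (n + 1) ++ Rw (n + 2)) (join (val1 R r) (bval b))
      (join x (join (val1 R s) y))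
    have e5 := toList_join (Rw (n + 1)) (Rw (n + 2)) x (join (val1 R s) y)
    have e6 := toList_cons_join (val1 R s) y
    have e7 := toList_cons_join (val1 R r) (bval b)
    refine .trans ?_ e3.symm
    refine .trans ?_ (congrArg _ (e4.trans (congrArg₂ (· ++ ·) e7 (e5.trans (congrArg _ e6))))).symm
    rw [toList_join [B, R], toList_join _ (Rw (n + 1)), toList_join (B :: Rw (n + 1))]
    refine (congrArg₂ (· ++ ·) e1 (congrArg (· ++ _) (congrArg (· ++ _) e2))).trans ?_
    simp

/-- Integration against a mixture. -/
theorem lintegral_mix {m n : ℕ} (p : unitInterval) (c d : Circ (Rw m) (Rw n)) (x : Val (Rw m))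
    {F : Val (Rw n) → ℝ≥0∞} (hF : Measurable F) :
    ∫⁻ y, F y ∂(mix p c d).sem x = ENNReal.ofReal p * ∫⁻ y, F y ∂c.sem x +
      ENNReal.ofReal (1 - p) * ∫⁻ y, F y ∂d.sem x := by
  have hG := hF.lintegral_kernel (κ := (ifteW n).sem)
  have key : ∀ b : Bool, ∫⁻ y', ∫⁻ y, F y ∂(ifteW n).sem (join (bval b) y')
      ∂(c ⊠ d).sem (join x x) = if b then ∫⁻ y, F y ∂c.sem x else ∫⁻ y, F y ∂d.sem x := by
    intro b
    have hGb : Measurable fun y' : Val (Rw n ++ Rw n) =>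
        ∫⁻ y, F y ∂(ifteW n).sem (join (bval b) y') :=
      hG.comp (measurable_join.comp measurable_prodMk_left)
    rw [lintegral_par _ _ _ _ hGb]
    simp only [ifteW_sem, lintegral_dirac' _ hF]
    cases b <;> simp
  have h1 := lintegral_par (flip p) (c ⊠ d) nilVal (join x x) hG
  rw [mix, lintegral_seq _ _ _ hF]
  refine (lintegral_seq (copyW (Rw m)) (flip p ⊠ c ⊠ d) x hG).trans ?_
  rw [copyW_sem]
  refine (lintegral_dirac' _ (hG.lintegral_kernel (κ := (flip p ⊠ c ⊠ d).sem))).trans ?_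
  refine h1.trans ?_
  rw [lintegral_flip, key, key]
  · simp
  · exact Measurable.lintegral_prod_right (hG.comp measurable_join)

end CGM

/-! ### Linear independence of exponentials of polynomials -/

namespace CGM

open Col Circ Filter Topology
open scoped CGM.Circ ENNReal

/-- The restriction of a multivariate polynomial to the line through `0` and `z`. -/
theorem eval_aeval_line {σ : Type*} (z : σ → ℝ) (s : ℝ) (P : MvPolynomial σ ℝ) :
    (MvPolynomial.aeval (fun i => Polynomial.C (z i) * Polynomial.X) P).eval s =
      MvPolynomial.eval (fun i => z i * s) P := by
  induction P using MvPolynomial.induction_on with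
  | C a => simp
  | add p q hp hq => simp [hp, hq]
  | mul_X p i hp => simp [hp]

/-- Finitely many distinct polynomials take distinct values at a suitable point. -/
theorem exists_eval_injOn {σ : Type*} (S : Finset (MvPolynomial σ ℝ)) :
    ∃ z : σ → ℝ, Set.InjOn (MvPolynomial.eval z) S := by
  classical
  have h : ∏ q ∈ S.offDiag, (q.1 - q.2) ≠ 0 := by
    refine Finset.prod_ne_zero_iff.2 fun q hq => sub_ne_zero.2 (Finset.mem_offDiag.1 hq).2.2
  obtain ⟨z, hz⟩ : ∃ z, MvPolynomial.eval z (∏ q ∈ S.offDiag, (q.1 - q.2)) ≠ 0 := by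
    by_contra! h0
    exact h (MvPolynomial.funext fun z => by rw [h0 z, map_zero])
  refine ⟨z, fun p hp q hq hpq => by_contra fun hne => ?_⟩
  rw [map_prod, Finset.prod_ne_zero_iff] at hz
  exact hz (p, q) (Finset.mem_offDiag.2 ⟨hp, hq, hne⟩) (by simp [hpq])

/-- Exponentials of distinct polynomials in one variable without constant term are linearly
independent: the term that grows fastest cannot be cancelled. -/
theorem sum_exp_polynomial_ne_zero {ι : Type*} {S : Finset ι} (hS : S.Nonempty) {a : ι → ℝ}
    (ha : ∀ k ∈ S, a k ≠ 0) {p : ι → Polynomial ℝ} (h0 : ∀ k ∈ S, (p k).eval 0 = 0)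
    (hp : Set.InjOn p S) : ¬ ∀ s, ∑ k ∈ S, a k * Real.exp ((p k).eval s) = 0 := by
  intro h
  classical
  -- The dominant exponent: maximal for the eventual order at infinity.
  obtain ⟨k₀, hk₀, hmax⟩ := S.exists_maximalFor
    (fun k => ((fun s => (p k).eval s : ℝ → ℝ) : Germ (atTop : Filter ℝ) ℝ)) hS
  have key : ∀ k ∈ S, k ≠ k₀ → Tendsto (fun s => (p k - p k₀).eval s) atTop atBot := by
    intro k hk hne
    have hdeg : 0 < (p k - p k₀).degree := by
      by_contra! hle
      have hC := Polynomial.eq_C_of_degree_le_zero hle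
      have h1 : (p k - p k₀).coeff 0 = 0 := by
        rw [Polynomial.coeff_zero_eq_eval_zero, Polynomial.eval_sub, h0 k hk, h0 k₀ hk₀, sub_zero]
      rw [h1, map_zero, sub_eq_zero] at hC
      exact hne (hp hk hk₀ hC)
    rcases le_total 0 (p k - p k₀).leadingCoeff with hl | hl
    · exfalso
      have ht := Polynomial.tendsto_atTop_of_leadingCoeff_nonneg _ hdeg hl
      have h1 : ∀ᶠ s in atTop, (p k₀).eval s ≤ (p k).eval s := by
        filter_upwards [ht.eventually_ge_atTop 0] with s hs
        simpa using hs
      have h2 : ∀ᶠ s in atTop, (p k).eval s ≤ (p k₀).eval s :=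
        Germ.coe_le.1 (hmax hk (Germ.coe_le.2 h1))
      obtain ⟨s, hs, hs'⟩ := (h2.and (ht.eventually_ge_atTop 1)).exists
      rw [Polynomial.eval_sub] at hs'
      linarith
    · exact Polynomial.tendsto_atBot_of_leadingCoeff_nonpos _ hdeg hl
  -- Divided by the dominant exponential, the sum tends to the coefficient of that exponential.
  have h1 : ∀ s, ∑ k ∈ S, a k * Real.exp ((p k - p k₀).eval s) = 0 := by
    intro s
    have : ∀ k ∈ S, a k * Real.exp ((p k - p k₀).eval s) =
        a k * Real.exp ((p k).eval s) * Real.exp (-(p k₀).eval s) := by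
      intro k _
      rw [mul_assoc, ← Real.exp_add, Polynomial.eval_sub, sub_eq_add_neg]
    rw [Finset.sum_congr rfl this, ← Finset.sum_mul, h s, zero_mul]
  have h2 : Tendsto (fun s => ∑ k ∈ S, a k * Real.exp ((p k - p k₀).eval s)) atTop
      (𝓝 (∑ k ∈ S, if k = k₀ then a k₀ else 0)) := by
    refine tendsto_finsetSum _ fun k hk => ?_
    split_ifs with hkk
    · subst hkk
      simp
    · simpa using (Real.tendsto_exp_atBot.comp (key k hk hkk)).const_mul (a k)
  rw [Finset.sum_ite_eq' S k₀, if_pos hk₀] at h2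
  simp only [h1] at h2
  exact ha k₀ hk₀ (tendsto_nhds_unique h2 tendsto_const_nhds)

/-- Exponentials of distinct polynomials without constant term are linearly independent. -/
theorem eq_zero_of_sum_exp_eq_zero {σ : Type*} {a : MvPolynomial σ ℝ →₀ ℝ}
    (h0 : ∀ P ∈ a.support, MvPolynomial.eval 0 P = 0)
    (h : ∀ z, (a.sum fun P r => r * Real.exp (MvPolynomial.eval z P)) = 0) : a = 0 := by
  by_contra ha
  obtain ⟨z, hz⟩ := exists_eval_injOn a.support
  refine sum_exp_polynomial_ne_zero (Finsupp.support_nonempty_iff.2 ha) (a := a)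
    (fun k hk => Finsupp.mem_support_iff.1 hk)
    (p := MvPolynomial.aeval (fun i => Polynomial.C (z i) * Polynomial.X)) ?_ ?_ fun s => ?_
  · intro P hP
    rw [eval_aeval_line]
    simpa [Pi.zero_def] using h0 P hP
  · intro P hP Q hQ hPQ
    refine hz hP hQ ?_
    have := congrArg (Polynomial.eval 1) hPQ
    simpa [eval_aeval_line] using this
  · simp only [eval_aeval_line]
    exact h _

/-! ### Moment generating functions of Gaussian circuits -/

/-- The value of a wire as a real number; a Boolean counts as `0` or `1`. -/
def Col.num : (a : Col) → a.Ty → ℝ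
  | B => fun b : Bool => if b then 1 else 0
  | R => fun r : ℝ => r

/-- The linear form with coefficients `t` on the values of a word. -/
def linForm : (v : List Col) → (ℕ → ℝ) → Val v → ℝ
  | [], _, _ => 0
  | a :: v, t, x => t 0 * a.num x.1 + linForm v (fun i => t (i + 1)) x.2

theorem measurable_num : (a : Col) → Measurable a.num
  | B => measurable_of_countable (α := Bool) _
  | R => measurable_id

theorem measurable_linForm (v : List Col) (t : ℕ → ℝ) : Measurable (linForm v t) := by
  induction v generalizing t with
  | nil => exact measurable_const
  | cons a v ih =>
    exact (((measurable_num a).comp measurable_fst).const_mul _).add ((ih _).comp measurable_snd)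

theorem linForm_join (v w : List Col) (t : ℕ → ℝ) (x : Val v) (y : Val w) :
    linForm (v ++ w) t (join x y) = linForm v t x + linForm w (fun i => t (i + v.length)) y := by
  induction v generalizing t with
  | nil => exact (zero_add _).symm
  | cons a v ih =>
    refine (congrArg (t 0 * a.num x.1 + ·) (ih (fun i => t (i + 1)) x.2)).trans ?_
    rw [← add_assoc, linForm, List.length_cons]
    simp only [add_assoc]

theorem linForm_congr {v : List Col} {t t' : ℕ → ℝ} (h : ∀ i < v.length, t i = t' i) (x : Val v) :
    linForm v t x = linForm v t' x := by
  induction v generalizing t t' with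
  | nil => rfl
  | cons a v ih =>
    rw [linForm, linForm, h 0 (by simp), ih fun i hi => h (i + 1) (by simpa using hi)]

theorem linForm_smul (v : List Col) (s : ℝ) (t : ℕ → ℝ) (x : Val v) :
    linForm v (fun i => s * t i) x = s * linForm v t x := by
  induction v generalizing t with
  | nil => simp [linForm]
  | cons a v ih => rw [linForm, linForm, ih (fun i => t (i + 1))]; ring

/-- The moment generating function of a circuit with input `x`. -/
noncomputable def mgfCirc {v w : List Col} (c : Circ v w) (x : Val v) (t : ℕ → ℝ) : ℝ≥0∞ :=
  ∫⁻ y, ENNReal.ofReal (Real.exp (linForm w t y)) ∂c.sem x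

theorem measurable_exp_linForm (v : List Col) (t : ℕ → ℝ) :
    Measurable fun y => ENNReal.ofReal (Real.exp (linForm v t y)) :=
  (Real.measurable_exp.comp (measurable_linForm v t)).ennreal_ofReal

theorem mgfCirc_of_dirac {v w : List Col} {c : Circ v w} {x : Val v} {y : Val w}
    (h : c.sem x = Measure.dirac y) (t : ℕ → ℝ) :
    mgfCirc c x t = ENNReal.ofReal (Real.exp (linForm w t y)) := by
  rw [mgfCirc, h, lintegral_dirac' _ (measurable_exp_linForm w t)]

/-- The value of a single real wire. -/
def rval (r : ℝ) : Val [R] := val1 R r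

theorem mgfCirc_nn (x : Val []) (t : ℕ → ℝ) :
    mgfCirc nn x t = ENNReal.ofReal (Real.exp (t 0 ^ 2 / 2)) := by
  have h : nn.sem x = (gaussianReal 0 1).map rval := by
    rw [Circ.sem, Gen.sem]
    exact Kernel.const_apply _ _
  have hm : Measurable rval := measurable_id.prodMk measurable_const
  have h1 := congrFun (mgf_id_gaussianReal (μ := 0) (v := 1)) (t 0)
  rw [mgfCirc, h, lintegral_map (measurable_exp_linForm _ t) hm]
  have h2 : ∀ r : ℝ, linForm [R] t (rval r) = t 0 * r := fun r => add_zero _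
  simp only [h2]
  erw [← ofReal_integral_eq_lintegral_ofReal (integrable_exp_mul_gaussianReal (t 0))
    (ae_of_all _ fun _ => (Real.exp_pos _).le)]
  rw [mgf] at h1
  simp only [id] at h1
  rw [h1]
  simp

/-- The moment generating function of a Gaussian circuit is the exponential of a polynomial that
is affine in the input.

The statement includes words with Boolean wires: they can occur inside a Gaussian circuit, between
identities and symmetries. -/
theorem exists_mgfCirc_eq {v w : List Col} (c : Circ v w) (hc : c.IsGauss) :
    ∃ (T : ℕ → MvPolynomial ℕ ℝ) (r : MvPolynomial ℕ ℝ), ∀ x t,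
      mgfCirc c x t = ENNReal.ofReal (Real.exp
        (linForm v (fun i => MvPolynomial.eval t (T i)) x + MvPolynomial.eval t r)) := by
  open MvPolynomial in
  induction c with
  | gen g =>
    cases g with
    | copy a =>
      refine ⟨fun _ => X 0 + X 1, 0, fun x t => ?_⟩
      obtain ⟨r, rfl⟩ : ∃ r, x = val1 a r := ⟨x.1, rfl⟩
      rw [mgfCirc_of_dirac (copy_sem_val1 a r)]
      congr 2
      change t 0 * a.num r + (t 1 * a.num r + 0) = eval t (X 0 + X 1) * a.num r + 0 + eval t 0
      simp
      ring
    | del a =>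
      refine ⟨fun _ => 0, 0, fun x t => ?_⟩
      rw [mgfCirc_of_dirac (y := nilVal) (by
        rw [Circ.sem, Gen.sem]; exact Kernel.deterministic_apply _ _)]
      congr 2
      change 0 = eval t 0 * _ + 0 + eval t 0
      simp
    | andg => exact hc.elim
    | notg => exact hc.elim
    | flip p => exact hc.elim
    | zero =>
      refine ⟨fun _ => 0, 0, fun x t => ?_⟩
      rw [mgfCirc_of_dirac (y := val1 R (0 : ℝ)) (by
        rw [Circ.sem, Gen.sem]; exact Kernel.deterministic_apply _ _)]
      congr 2
      change t 0 * 0 + 0 = 0 + eval t 0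
      simp
    | add =>
      refine ⟨fun _ => X 0, 0, fun x t => ?_⟩
      obtain ⟨a, b, rfl⟩ : ∃ a b : ℝ, x = join (val1 R a) (val1 R b) := ⟨x.1, x.2.1, rfl⟩
      rw [mgfCirc_of_dirac (y := val1 R (a + b : ℝ)) (by
        rw [Circ.sem, Gen.sem]; exact Kernel.deterministic_apply _ _)]
      congr 2
      change t 0 * (a + b) + 0 = eval t (X 0) * a + (eval t (X 0) * b + 0) + eval t 0
      simp
      ring
    | scal k =>
      refine ⟨fun _ => C k * X 0, 0, fun x t => ?_⟩
      obtain ⟨a, rfl⟩ : ∃ a : ℝ, x = val1 R a := ⟨x.1, rfl⟩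
      rw [mgfCirc_of_dirac (y := val1 R (k * a : ℝ)) (by
        rw [Circ.sem, Gen.sem]; exact Kernel.deterministic_apply _ _)]
      congr 2
      change t 0 * (k * a) + 0 = eval t (C k * X 0) * a + 0 + eval t 0
      simp
      ring
    | one =>
      refine ⟨fun _ => 0, X 0, fun x t => ?_⟩
      rw [mgfCirc_of_dirac (y := val1 R (1 : ℝ)) (by
        rw [Circ.sem, Gen.sem]; exact Kernel.deterministic_apply _ _)]
      congr 2
      change t 0 * 1 + 0 = 0 + eval t (X 0)
      simp
    | nn =>
      refine ⟨fun _ => 0, C (1 / 2) * X 0 ^ 2, fun x t => ?_⟩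
      refine (mgfCirc_nn x t).trans ?_
      congr 2
      change _ = 0 + eval t _
      simp
      ring
    | ifte => exact hc.elim
  | idw v => exact ⟨X, 0, fun x t => by simp [mgfCirc_of_dirac (idw_sem_apply v x)]⟩
  | swap v w =>
    refine ⟨fun i => if i < v.length then X (i + w.length) else X (i - v.length), 0, fun x t => ?_⟩
    obtain ⟨x, y, rfl⟩ := exists_join x
    rw [mgfCirc_of_dirac (swap_sem_apply x y), linForm_join, linForm_join, add_comm, map_zero,
      add_zero]
    congr 3
    · exact linForm_congr (fun i hi => by simp [hi]) x
    · simp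
  | @seq u v w c d ihc ihd =>
    obtain ⟨T, r, h⟩ := ihc hc.1
    obtain ⟨T', r', h'⟩ := ihd hc.2
    -- Integrating over the output of `d` replaces the dual variables `t` by `T' t`.
    refine ⟨fun i => bind₁ T' (T i), bind₁ T' r + r', fun x t => ?_⟩
    have hb : ∀ P, eval t (bind₁ T' P) = eval (fun i => eval t (T' i)) P := fun P =>
      eval₂Hom_bind₁ _ _ _ _
    rw [mgfCirc, lintegral_seq _ _ _ (measurable_exp_linForm w t)]
    change ∫⁻ y, mgfCirc d y t ∂c.sem x = _
    simp only [h', Real.exp_add, ENNReal.ofReal_mul (Real.exp_pos _).le]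
    rw [lintegral_mul_const _ (measurable_exp_linForm _ _)]
    change mgfCirc c x _ * _ = _
    rw [h, ← ENNReal.ofReal_mul (Real.exp_pos _).le, ← ENNReal.ofReal_mul (Real.exp_pos _).le,
      ← Real.exp_add, ← Real.exp_add]
    simp only [hb, map_add, add_assoc]
  | @par v w v' w' c d ihc ihd =>
    obtain ⟨T, r, h⟩ := ihc hc.1
    obtain ⟨T', r', h'⟩ := ihd hc.2
    refine ⟨fun i => if i < v.length then T i else rename (· + w.length) (T' (i - v.length)),
      r + rename (· + w.length) r', fun x t => ?_⟩
    obtain ⟨x, x', rfl⟩ := exists_join x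
    rw [mgfCirc, lintegral_par _ _ _ _ (measurable_exp_linForm _ t)]
    simp only [linForm_join, Real.exp_add, ENNReal.ofReal_mul (Real.exp_pos _).le]
    simp only [lintegral_const_mul _ (measurable_exp_linForm _ _)]
    rw [lintegral_mul_const _ (measurable_exp_linForm _ _)]
    change mgfCirc c x _ * mgfCirc d x' _ = _
    rw [h, h']
    simp only [← ENNReal.ofReal_mul (Real.exp_pos _).le, ← Real.exp_add]
    have e1 : linForm v (fun i => eval t (if i < v.length then T i else
        rename (· + w.length) (T' (i - v.length)))) x = linForm v (fun i => eval t (T i)) x :=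
      linForm_congr (fun i hi => by simp [hi]) x
    rw [e1]
    congr 2
    simp only [map_add, eval_rename, Nat.add_sub_cancel, not_lt.2 (Nat.le_add_left _ _), if_false,
      Function.comp_def]
    ring

end CGM

/-! ### The moment generating function determines a Gaussian circuit -/

namespace CGM

open Col Circ
open scoped CGM.Circ ENNReal

/-- The value of `R^n` with the entries `f 0, …, f (n - 1)`. -/
def ofFun : (n : ℕ) → (ℕ → ℝ) → Val (Rw n)
  | 0, _ => nilVal
  | n + 1, f => ((f 0, ofFun n fun i => f (i + 1)) : ℝ × Val (Rw n))

/-- The entries of a value of `R^n`, continued by `0`. -/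
def toFun : (n : ℕ) → Val (Rw n) → ℕ → ℝ
  | 0, _, _ => 0
  | _ + 1, x, 0 => (x : ℝ × _).1
  | n + 1, x, i + 1 => toFun n (x : ℝ × _).2 i

theorem ofFun_congr (n : ℕ) {f g : ℕ → ℝ} (h : ∀ i < n, f i = g i) : ofFun n f = ofFun n g := by
  induction n generalizing f g with
  | zero => rfl
  | succ n ih => exact Prod.ext (h 0 (by simp)) (ih fun i hi => h _ (by simpa using hi))

theorem ofFun_toFun (n : ℕ) (x : Val (Rw n)) : ofFun n (toFun n x) = x := by
  induction n with
  | zero => rfl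
  | succ n ih => exact Prod.ext rfl (ih _)

theorem measurable_ofFun (n : ℕ) : Measurable (ofFun n) := by
  induction n with
  | zero => exact measurable_const
  | succ n ih =>
    exact (measurable_pi_apply 0).prodMk
      (ih.comp (measurable_pi_lambda _ fun i => measurable_pi_apply (i + 1)))

theorem linForm_ofFun (n : ℕ) (t f : ℕ → ℝ) :
    linForm (Rw n) t (ofFun n f) = ∑ i ∈ Finset.range n, t i * f i := by
  induction n generalizing t f with
  | zero => rfl
  | succ n ih =>
    rw [Finset.sum_range_succ', add_comm (Finset.sum _ _)]
    exact congrArg (t 0 * f 0 + ·) (ih (fun i => t (i + 1)) fun i => f (i + 1))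

theorem linForm_Rw (n : ℕ) (t : ℕ → ℝ) (x : Val (Rw n)) :
    linForm (Rw n) t x = ∑ i ∈ Finset.range n, t i * toFun n x i := by
  rw [← linForm_ofFun, ofFun_toFun]

theorem measurable_toFun (n i : ℕ) : Measurable fun x => toFun n x i := by
  induction n generalizing i with
  | zero => exact measurable_const
  | succ n ih =>
    cases i with
    | zero => exact measurable_fst (α := ℝ) (β := Val (Rw n))
    | succ i => exact (ih i).comp (measurable_snd (α := ℝ) (β := Val (Rw n)))

/-- In one dimension, a moment generating function that is finite everywhere determines the law. -/
theorem map_linForm_eq {n : ℕ} {μ ν : Measure (Val (Rw n))} [IsProbabilityMeasure μ]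
    [IsProbabilityMeasure ν]
    (h : ∀ t, ∫⁻ y, ENNReal.ofReal (Real.exp (linForm (Rw n) t y)) ∂μ =
      ∫⁻ y, ENNReal.ofReal (Real.exp (linForm (Rw n) t y)) ∂ν)
    (hfin : ∀ t, ∫⁻ y, ENNReal.ofReal (Real.exp (linForm (Rw n) t y)) ∂μ ≠ ⊤) (t : ℕ → ℝ) :
    μ.map (linForm (Rw n) t) = ν.map (linForm (Rw n) t) := by
  have hm := measurable_linForm (Rw n) t
  have hm' (s : ℝ) : Measurable fun y => Real.exp (s * linForm (Rw n) t y) :=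
    Real.measurable_exp.comp (hm.const_mul s)
  have hmgf : mgf (linForm (Rw n) t) μ = mgf (linForm (Rw n) t) ν := by
    ext s
    rw [mgf, mgf, integral_eq_lintegral_of_nonneg_ae (ae_of_all _ fun _ => (Real.exp_pos _).le)
      (hm' s).aestronglyMeasurable, integral_eq_lintegral_of_nonneg_ae
      (ae_of_all _ fun _ => (Real.exp_pos _).le) (hm' s).aestronglyMeasurable]
    simp only [← linForm_smul]
    rw [h]
  have hset : integrableExpSet (linForm (Rw n) t) μ = Set.univ := by
    refine Set.eq_univ_of_forall fun s => ⟨(hm' s).aestronglyMeasurable, ?_⟩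
    rw [hasFiniteIntegral_iff_ofReal (ae_of_all _ fun _ => (Real.exp_pos _).le)]
    simp only [← linForm_smul]
    exact (hfin _).lt_top
  refine Measure.ext_of_complexMGF_eq hm.aemeasurable hm.aemeasurable (funext fun z => ?_)
  exact eqOn_complexMGF_of_mgf hmgf (by simp [hset])

/-- A law on `R^n` is determined by its one-dimensional projections (Cramér–Wold). -/
theorem eq_of_map_linForm_eq {n : ℕ} {μ ν : Measure (Val (Rw n))} [IsProbabilityMeasure μ]
    [IsProbabilityMeasure ν]
    (h : ∀ t, μ.map (linForm (Rw n) t) = ν.map (linForm (Rw n) t)) : μ = ν := by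
  let e : Val (Rw n) → Fin n → ℝ := fun x i => toFun n x i
  let e' : (Fin n → ℝ) → Val (Rw n) := fun f => ofFun n fun i => if h : i < n then f ⟨i, h⟩ else 0
  have he : Measurable e := measurable_pi_lambda _ fun i => measurable_toFun n i
  have he' : Measurable e' := by
    refine (measurable_ofFun n).comp (measurable_pi_lambda _ fun i => ?_)
    split_ifs
    · exact measurable_pi_apply _
    · exact measurable_const
  have hee (x) : e' (e x) = x := by
    refine (ofFun_congr n fun i hi => ?_).trans (ofFun_toFun n x)
    simp [e, hi]
  have hmap : μ.map e = ν.map e := by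
    refine Measure.ext_of_charFunDual (funext fun L => ?_)
    have hL : L ∘ e =
        linForm (Rw n) fun i => if h : i < n then L (Pi.single ⟨i, h⟩ 1) else 0 := by
      ext x
      rw [linForm_Rw, Finset.sum_range]
      conv_lhs => rw [Function.comp_apply, ← Finset.univ_sum_single (e x), map_sum]
      refine Finset.sum_congr rfl fun i _ => ?_
      have : Pi.single i (e x i) = e x i • (Pi.single i 1 : Fin n → ℝ) := by
        rw [← Pi.single_smul]; simp
      rw [this, map_smul, smul_eq_mul, mul_comm]
      simp [e]
    rw [charFunDual_eq_charFun_map_one, charFunDual_eq_charFun_map_one,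
      Measure.map_map (by fun_prop) he, Measure.map_map (by fun_prop) he, hL, h]
  have := congrArg (Measure.map e') hmap
  rw [Measure.map_map he' he, Measure.map_map he' he] at this
  simpa [Function.comp_def, hee] using this

/-- The polynomial `P` describes the Gaussian law of `c`: it is the logarithm of the moment
generating function, as a polynomial in the inputs `Sum.inl i` and the dual variables
`Sum.inr i`. -/
def HasLogMGF {m n : ℕ} (P : MvPolynomial (ℕ ⊕ ℕ) ℝ) (c : Circ (Rw m) (Rw n)) : Prop :=
  ∀ z : ℕ ⊕ ℕ → ℝ, mgfCirc c (ofFun m (z ∘ Sum.inl)) (z ∘ Sum.inr) =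
    ENNReal.ofReal (Real.exp (MvPolynomial.eval z P))

theorem exists_hasLogMGF {m n : ℕ} (c : Circ (Rw m) (Rw n)) (hc : c.IsGauss) :
    ∃ P, HasLogMGF P c := by
  open MvPolynomial in
  obtain ⟨T, r, h⟩ := exists_mgfCirc_eq c hc
  refine ⟨∑ i ∈ Finset.range m, rename Sum.inr (T i) * X (Sum.inl i) + rename Sum.inr r,
    fun z => ?_⟩
  rw [h, linForm_ofFun]
  simp [eval_rename]

/-- At `0`, the moment generating function is the total mass `1`. -/
theorem HasLogMGF.eval_zero {m n : ℕ} {P : MvPolynomial (ℕ ⊕ ℕ) ℝ} {c : Circ (Rw m) (Rw n)}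
    (h : HasLogMGF P c) : MvPolynomial.eval 0 P = 0 := by
  have h1 := h 0
  have h2 (y : Val (Rw n)) : linForm (Rw n) ((0 : ℕ ⊕ ℕ → ℝ) ∘ Sum.inr) y = 0 := by
    simp [linForm_Rw]
  simp only [mgfCirc, h2, Real.exp_zero, ENNReal.ofReal_one, lintegral_const, measure_univ,
    mul_one] at h1
  have h3 := congrArg ENNReal.toReal h1
  rw [ENNReal.toReal_ofReal (Real.exp_pos _).le] at h3
  exact Real.exp_eq_one_iff _ |>.1 h3.symm

/-- The moment generating function determines the interpretation. -/
theorem HasLogMGF.sem_eq {m n : ℕ} {P : MvPolynomial (ℕ ⊕ ℕ) ℝ} {c d : Circ (Rw m) (Rw n)}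
    (hc : HasLogMGF P c) (hd : HasLogMGF P d) : c.sem = d.sem := by
  ext1 x
  have hz (t : ℕ → ℝ) : mgfCirc c x t = ENNReal.ofReal (Real.exp
        (MvPolynomial.eval (Sum.elim (toFun m x) t) P)) ∧ mgfCirc d x t = mgfCirc c x t := by
    have h1 := hc (Sum.elim (toFun m x) t)
    have h2 := hd (Sum.elim (toFun m x) t)
    rw [Sum.elim_comp_inl, Sum.elim_comp_inr, ofFun_toFun] at h1 h2
    exact ⟨h1, h2.trans h1.symm⟩
  refine eq_of_map_linForm_eq (map_linForm_eq (fun t => (hz t).2.symm) fun t => ?_)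
  rw [← mgfCirc, (hz t).1]
  exact ENNReal.ofReal_ne_top

end CGM

/-! ### Circuits in convex normal form -/

namespace CGM

open Col Circ
open scoped CGM.Circ ENNReal

theorem Eqv.mono {A A' : ∀ ⦃v w : List Col⦄, Circ v w → Circ v w → Prop}
    (hA : ∀ {v w : List Col} {c d : Circ v w}, A c d → A' c d) {v w v' w' : List Col}
    {c : Circ v w} {d : Circ v' w'} (h : Eqv A c d) : Eqv A' c d := by
  induction h with
  | ax h => exact .ax (hA h)
  | refl c => exact .refl c
  | symm _ ih => exact ih.symm
  | trans _ _ ih ih' => exact ih.trans ih'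
  | seq_congr _ _ ih ih' => exact .seq_congr ih ih'
  | par_congr _ _ ih ih' => exact .par_congr ih ih'
  | seq_assoc c d e => exact .seq_assoc c d e
  | id_seq c => exact .id_seq c
  | seq_id c => exact .seq_id c
  | par_assoc c d e => exact .par_assoc c d e
  | nil_par c => exact .nil_par c
  | par_nil c => exact .par_nil c
  | id_par_id v w => exact .id_par_id v w
  | interchange c d c' d' => exact .interchange c d c' d'
  | swap_natural c d => exact .swap_natural c d
  | swap_swap v w => exact .swap_swap v w
  | swap_nil v => exact .swap_nil v
  | hexagon u v w => exact .hexagon u v w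

theorem SMCEq.cgmEq {v w : List Col} {c d : Circ v w} (h : SMCEq c d) : CGMEq c d :=
  Eqv.mono (fun h => h.elim) h

theorem convexLaws_mixOp (m n : ℕ) : ConvexLaws (mixOp (m := m) (n := n)) where
  one := mixOp_one
  self := mixOp_self
  symm := mixOp_symm
  skew h₁ h₂ := mixOp_skew h₁ h₂

/-- The morphisms given by Gaussian circuits, labelled by the logarithms of their moment generating
functions. -/
def GaussLeaf (m n : ℕ) (P : MvPolynomial (ℕ ⊕ ℕ) ℝ) (f : Rw m ⟶ Rw n) : Prop :=
  ∃ c : Circ (Rw m) (Rw n), c.IsGauss ∧ HasLogMGF P c ∧ hom c = f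

theorem GaussLeaf.unique {m n : ℕ} (P : MvPolynomial (ℕ ⊕ ℕ) ℝ) (f g : Rw m ⟶ Rw n)
    (hf : GaussLeaf m n P f) (hg : GaussLeaf m n P g) : f = g := by
  obtain ⟨c, hc, hPc, rfl⟩ := hf
  obtain ⟨d, hd, hPd, rfl⟩ := hg
  exact eqv_ax (.gauss c d hc hd (hPc.sem_eq hPd))

/-- The moment generating function of a mixture with weights `w`. -/
noncomputable def mixMGF (w : MvPolynomial (ℕ ⊕ ℕ) ℝ →₀ ℝ) (z : ℕ ⊕ ℕ → ℝ) : ℝ :=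
  w.sum fun P r => r * Real.exp (MvPolynomial.eval z P)

theorem mixMGF_add (w w' : MvPolynomial (ℕ ⊕ ℕ) ℝ →₀ ℝ) (z : ℕ ⊕ ℕ → ℝ) :
    mixMGF (w + w') z = mixMGF w z + mixMGF w' z :=
  Finsupp.sum_add_index' (by simp) fun _ _ _ => add_mul _ _ _

theorem mixMGF_smul (r : ℝ) (w : MvPolynomial (ℕ ⊕ ℕ) ℝ →₀ ℝ) (z : ℕ ⊕ ℕ → ℝ) :
    mixMGF (r • w) z = r * mixMGF w z := by
  rw [mixMGF, mixMGF, Finsupp.sum_smul_index (by simp), Finsupp.mul_sum]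
  simp only [mul_assoc]

theorem IsMix.mixMGF_nonneg {H : Type*} {op : unitInterval → H → H → H}
    {leaf : MvPolynomial (ℕ ⊕ ℕ) ℝ → H → Prop} {w : MvPolynomial (ℕ ⊕ ℕ) ℝ →₀ ℝ} {a : H}
    (h : IsMix op leaf w a) (z : ℕ ⊕ ℕ → ℝ) : 0 ≤ mixMGF w z :=
  Finset.sum_nonneg fun P _ => mul_nonneg (h.nonneg P) (Real.exp_pos _).le

theorem IsMix.eval_zero {m n : ℕ} {w : MvPolynomial (ℕ ⊕ ℕ) ℝ →₀ ℝ} {f : Rw m ⟶ Rw n}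
    (h : IsMix mixOp (GaussLeaf m n) w f) {P : MvPolynomial (ℕ ⊕ ℕ) ℝ} (hP : w P ≠ 0) :
    MvPolynomial.eval 0 P = 0 := by
  induction h with
  | leaf Q f hf =>
    obtain ⟨c, _, hQ, _⟩ := hf
    have hPQ : P = Q := by
      by_contra hne
      exact hP (Finsupp.single_eq_of_ne hne)
    exact hPQ ▸ hQ.eval_zero
  | mix p w w' f g _ _ _ _ ih ih' =>
    by_cases hw : w P = 0
    · refine ih' fun hw' => hP ?_
      simp [hw, hw']
    · exact ih hw

/-- A circuit in convex normal form is a mixture of Gaussian circuits, whose weights are also the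
coefficients of its moment generating function. -/
theorem IsCNF.exists_isMix {m n : ℕ} {c : Circ (Rw m) (Rw n)} (h : IsCNF c) :
    ∃ w, IsMix mixOp (GaussLeaf m n) w (hom c) ∧ ∀ z : ℕ ⊕ ℕ → ℝ,
      mgfCirc c (ofFun m (z ∘ Sum.inl)) (z ∘ Sum.inr) = ENNReal.ofReal (mixMGF w z) := by
  induction h with
  | gauss c hc =>
    obtain ⟨P, hP⟩ := exists_hasLogMGF c hc
    refine ⟨_, .leaf P _ ⟨c, hc, hP, rfl⟩, fun z => ?_⟩
    rw [hP z, mixMGF, Finsupp.sum_single_index (by simp), one_mul]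
  | mix p c d hp0 hp1 _ _ ih ih' =>
    obtain ⟨w, hw, hwz⟩ := ih
    obtain ⟨w', hw', hwz'⟩ := ih'
    refine ⟨_, (hom_mix p c d).symm ▸ IsMix.mix p w w' _ _ hp0 hp1 hw hw', fun z => ?_⟩
    have hp1' : (0 : ℝ) ≤ 1 - p := sub_nonneg.2 p.2.2
    rw [mgfCirc, lintegral_mix p c d _ (measurable_exp_linForm _ _), ← mgfCirc, ← mgfCirc, hwz,
      hwz', mixMGF_add, mixMGF_smul, mixMGF_smul, ENNReal.ofReal_add
      (mul_nonneg p.2.1 (hw.mixMGF_nonneg z)) (mul_nonneg hp1' (hw'.mixMGF_nonneg z)),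
      ENNReal.ofReal_mul p.2.1, ENNReal.ofReal_mul hp1']
  | smc c d hcd _ ih =>
    rw [← hom_eq_iff.2 hcd.cgmEq]
    simpa only [mgfCirc, hcd.sem_eq] using ih

end CGM

theorem mainTheorem7 (m n : ℕ) (c d : CGM.Circ (CGM.Rw m) (CGM.Rw n))
    (hc : CGM.IsCNF c) (hd : CGM.IsCNF d) (h : c.sem = d.sem) : CGM.CGMEq c d := by
  obtain ⟨w, hw, hwz⟩ := hc.exists_isMix
  obtain ⟨w', hw', hwz'⟩ := hd.exists_isMix
  have hz (z) : CGM.mixMGF w z = CGM.mixMGF w' z := by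
    rw [← ENNReal.ofReal_eq_ofReal_iff (hw.mixMGF_nonneg z) (hw'.mixMGF_nonneg z), ← hwz, ← hwz',
      CGM.mgfCirc, CGM.mgfCirc, h]
  have hww : w - w' = 0 := by
    refine CGM.eq_zero_of_sum_exp_eq_zero (fun P hP => ?_) fun z => ?_
    · by_cases hwP : w P = 0
      · refine hw'.eval_zero fun hwP' => Finsupp.mem_support_iff.1 hP ?_
        rw [Finsupp.sub_apply, hwP, hwP', sub_self]
      · exact hw.eval_zero hwP
    · have h1 := CGM.mixMGF_add w ((-1 : ℝ) • w') z
      rw [CGM.mixMGF_smul, hz, neg_one_smul, ← sub_eq_add_neg] at h1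
      exact h1.trans (by ring)
  rw [sub_eq_zero] at hww
  exact CGM.hom_eq_iff.1
    (hw.unique (CGM.convexLaws_mixOp m n) CGM.GaussLeaf.unique (hww ▸ hw'))
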